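/- Let $G^*$ be a connected plane graph (loops and parallel edges are allowed), given by a combinatorial embedding, in which every face, including the infinite face, is a triangle, i.e. is bounded by exactly three darts (a dart is an edge together with one of its two directions). Let $X$ be a set of $k\ge 4$ faces of $G^*$, called terminals. For a simple cycle $C$ of $G^*$, a face is in the exterior of $C$ if it can be reached from the infinite face by passing from face to face across edges that are not in $C$, and it is in the interior of $C$ otherwise. (i) For every spanning tree $T^*$ of $G^*$ there is an edge $e\notin T^*$ such that the fundamental cycle $S^*$ of $e$ in $T^*$ (the simple cycle consisting of $e$ and edges of $T^*$) has at most $\frac34 k$ of the terminals in its interior and at most $\frac34 k$ of the terminals in its exterior. (ii) There is an algorithm that, given $G^*$, $X$ and a spanning tree $T^*$ of $G^*$, finds such an edge $e$ and the edge set of its fundamental cycle $S^*$ in linear time. (iii) There is an algorithm that, given only $G^*$ and $X$, finds a spanning tree $T^*$, an edge $e\notin T^*$ and the edge set of the fundamental cycle $S^*$ of $e$ in $T^*$, such that $S^*$ is balanced as in (i), in linear time. Linear time means at most $C n$ steps of a unit-cost random access machine whose words hold the numbers $0,\dots,Cn$, where $n$ is the number of darts of $G^*$ (twice its number of edges) and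 $C$ is an absolute constant. The graph is given by its number of darts and by the tables of the two permutations of the darts that describe the embedding (reversal, and rotation about the tail); $X$ is given by marking the darts on the terminal faces, and $T^*$ by marking the darts of its edges. -/

import Mathlib

/-- A graph (loops and parallel edges allowed) cellularly embedded in an oriented closed surface,
given by its combinatorial map. `D` is the set of darts (each edge gives two opposite darts),
`rev` reverses a dart, and `rot` sends a dart to the next dart, in cyclic order, among
the darts with the same tail. -/
structure CombMap (D : Type*) where
  rev : Equiv.Perm D
  rot : Equiv.Perm D
  rev_rev : ∀ d, rev (rev d) = d
  rev_ne : ∀ d, rev d ≠ d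

namespace CombMap

variable {D : Type*} (G : CombMap D)

/-- The face permutation: the dart after `d` on the boundary of the face at `d`. -/
def facePerm : Equiv.Perm D := G.rot * G.rev

/-- Vertices are the orbits of `rot`. -/
abbrev Vertex : Type _ := Quotient (Equiv.Perm.SameCycle.setoid G.rot)

/-- Edges are the orbits of `rev`, that is, the pairs of opposite darts. -/
abbrev Edge : Type _ := Quotient (Equiv.Perm.SameCycle.setoid G.rev)

/-- Faces are the orbits of the face permutation. -/
abbrev Face : Type _ := Quotient (Equiv.Perm.SameCycle.setoid G.facePerm)

/-- The vertex from which the dart `d` starts. -/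
def tail (d : D) : G.Vertex := Quotient.mk _ d

/-- The vertex at which the dart `d` ends. -/
def head (d : D) : G.Vertex := G.tail (G.rev d)

/-- The edge of the dart `d`. -/
def edge (d : D) : G.Edge := Quotient.mk _ d

/-- The face whose boundary walk contains the dart `d`. The faces on the two sides of the edge
of `d` are `G.face d` and `G.face (G.rev d)`. -/
def face (d : D) : G.Face := Quotient.mk _ d

/-- `u` and `v` are joined by an edge of `F`. -/
def Step (F : Set G.Edge) (u v : G.Vertex) : Prop :=
  ∃ d, G.edge d ∈ F ∧ G.tail d = u ∧ G.head d = v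

/-- The edge set `F` connects all vertices. -/
def Spans (F : Set G.Edge) : Prop :=
  ∀ u v, Relation.ReflTransGen (G.Step F) u v

/-- The embedded graph is connected and the surface is the sphere (Euler's formula). -/
def IsPlane : Prop :=
  G.Spans Set.univ ∧
    (Nat.card G.Vertex : ℤ) - Nat.card G.Edge + Nat.card G.Face = 2

/-- Every face is bounded by exactly three darts. -/
def IsTriangulated : Prop := ∀ f : G.Face, {d | G.face d = f}.ncard = 3

/-- A simple cycle: a closed walk of `len + 1` darts (the index `i + 1` is cyclic) that
repeats neither a vertex nor an edge. -/
structure SimpleCycle where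
  len : ℕ
  dart : Fin (len + 1) → D
  closed : ∀ i, G.head (dart i) = G.tail (dart (i + 1))
  tail_injective : Function.Injective fun i => G.tail (dart i)
  edge_injective : Function.Injective fun i => G.edge (dart i)

variable {G} in
/-- The set of edges of a simple cycle. -/
def SimpleCycle.edges (c : G.SimpleCycle) : Set G.Edge := Set.range fun i => G.edge (c.dart i)

/-- `T` is (the edge set of) a spanning tree: connected on all vertices, and without cycles. -/
def IsSpanningTree (T : Set G.Edge) : Prop :=
  G.Spans T ∧ ∀ c : G.SimpleCycle, ¬ c.edges ⊆ T

/-- `c` is the fundamental cycle of the non-tree edge `e` with respect to `T`: it consists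
of `e` and of edges of `T`. -/
def IsFundamentalCycle (T : Set G.Edge) (e : G.Edge) (c : G.SimpleCycle) : Prop :=
  e ∉ T ∧ e ∈ c.edges ∧ c.edges ⊆ insert e T

/-- The faces `f` and `g` lie on the two sides of some edge outside `F`. -/
def DualStep (F : Set G.Edge) (f g : G.Face) : Prop :=
  ∃ d, G.edge d ∉ F ∧ G.face d = f ∧ G.face (G.rev d) = g

/-- The faces outside `c`: those that can be reached from the infinite face
without crossing an edge of `c`. -/
def exterior (infinite : G.Face) (c : G.SimpleCycle) : Set G.Face :=
  {f | Relation.ReflTransGen (G.DualStep c.edges) infinite f}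

/-- The faces enclosed by `c`. -/
def interior (infinite : G.Face) (c : G.SimpleCycle) : Set G.Face :=
  (G.exterior infinite c)ᶜ

/-- `c` has at most 3/4 of the terminal faces `X` inside and at most 3/4 of them outside. -/
def IsBalanced (infinite : G.Face) (X : Set G.Face) (c : G.SimpleCycle) : Prop :=
  ((X ∩ G.interior infinite c).ncard : ℝ) ≤ 3 / 4 * X.ncard ∧
    ((X ∩ G.exterior infinite c).ncard : ℝ) ≤ 3 / 4 * X.ncard

end CombMap

/-- Memory of a random access machine: registers, and zero-indexed arrays of words. A program
mentions only finitely many registers and arrays. -/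
structure RamState where
  reg : ℕ → ℕ
  arr : ℕ → ℕ → ℕ

namespace RamState

/-- Overwrite register `x`. -/
def setReg (s : RamState) (x v : ℕ) : RamState :=
  { s with reg := Function.update s.reg x v }

/-- Overwrite cell `i` of array `a`. -/
def setArr (s : RamState) (a i v : ℕ) : RamState :=
  { s with arr := Function.update s.arr a (Function.update (s.arr a) i v) }

end RamState

/-- Tests of the machine, comparing two registers. -/
inductive RamTest
  | lt (x y : ℕ)
  | eq (x y : ℕ)

/-- When a test succeeds. -/
def RamTest.Holds : RamTest → RamState → Prop
  | .lt x y, s => s.reg x < s.reg y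
  | .eq x y, s => s.reg x = s.reg y

/-- Programs of the machine: elementary instructions on single words, and structured control.
In the elementary instructions the first argument names the target. -/
inductive RamProg
  | skip
  | const (x c : ℕ)
  | move (x y : ℕ)
  | add (x y z : ℕ)
  | sub (x y z : ℕ)
  | load (x a y : ℕ)
  | store (a x y : ℕ)
  | seq (p q : RamProg)
  | ite (b : RamTest) (p q : RamProg)
  | loop (b : RamTest) (p : RamProg)

/-- `RamExec W p s t s'`: on a machine whose words hold the numbers up to `W`, the program `p`
started in `s` halts in `s'` after exactly `t` steps. Each elementary instruction and each
evaluation of a test is one step. A program that produces a number larger than `W` is stuck. -/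
inductive RamExec (W : ℕ) : RamProg → RamState → ℕ → RamState → Prop
  | skip (s) : RamExec W .skip s 1 s
  | const (s) (x c) (h : c ≤ W) : RamExec W (.const x c) s 1 (s.setReg x c)
  | move (s) (x y) : RamExec W (.move x y) s 1 (s.setReg x (s.reg y))
  | add (s) (x y z) (h : s.reg y + s.reg z ≤ W) :
      RamExec W (.add x y z) s 1 (s.setReg x (s.reg y + s.reg z))
  | sub (s) (x y z) : RamExec W (.sub x y z) s 1 (s.setReg x (s.reg y - s.reg z))
  | load (s) (x a y) : RamExec W (.load x a y) s 1 (s.setReg x (s.arr a (s.reg y)))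
  | store (s) (a x y) : RamExec W (.store a x y) s 1 (s.setArr a (s.reg x) (s.reg y))
  | seq {p q s s' s'' t t'} (h : RamExec W p s t s') (h' : RamExec W q s' t' s'') :
      RamExec W (.seq p q) s (t + t') s''
  | ite_true {b p q s t s'} (hb : b.Holds s) (h : RamExec W p s t s') :
      RamExec W (.ite b p q) s (1 + t) s'
  | ite_false {b p q s t s'} (hb : ¬ b.Holds s) (h : RamExec W q s t s') :
      RamExec W (.ite b p q) s (1 + t) s'
  | loop_done {b p s} (hb : ¬ b.Holds s) : RamExec W (.loop b p) s 1 s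
  | loop_step {b p s s' s'' t t'} (hb : b.Holds s) (h : RamExec W p s t s')
      (h' : RamExec W (.loop b p) s' t' s'') : RamExec W (.loop b p) s (1 + t + t') s''

open Classical in
/-- The bit of a proposition. -/
noncomputable def bit01 (p : Prop) : ℕ := if p then 1 else 0

/-- A table on `Fin n` written to an array, followed by zeros. -/
def tableArr {n : ℕ} (g : Fin n → ℕ) (i : ℕ) : ℕ := if h : i < n then g ⟨i, h⟩ else 0

namespace CombMap

variable {n : ℕ} (G : CombMap (Fin n))

/-- The input: register 0 holds the number `n` of darts; arrays 0 and 1 hold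
the tables of `rev` and `rot`; array 2 marks the darts on terminal faces; array 3 marks the darts
of the edges in `T`. Everything else is zero, so for `T = ∅` no edge set is supplied. -/
noncomputable def inputState (X : Set G.Face) (T : Set G.Edge) : RamState where
  reg x := if x = 0 then n else 0
  arr a := match a with
    | 0 => tableArr fun d => (G.rev d : ℕ)
    | 1 => tableArr fun d => (G.rot d : ℕ)
    | 2 => tableArr fun d => bit01 (G.face d ∈ X)
    | 3 => tableArr fun d => bit01 (G.edge d ∈ T)
    | _ => fun _ => 0

/-- The output: array 3 marks the darts of the edges in `T`, register 1 holds a dart of the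
edge `e`, and array 4 marks the darts of the edges of the cycle `c`. -/
def IsOutput (s : RamState) (T : Set G.Edge) (e : G.Edge) (c : G.SimpleCycle) : Prop :=
  (∀ d : Fin n, s.arr 3 d = bit01 (G.edge d ∈ T)) ∧
    (∃ d : Fin n, s.reg 1 = d ∧ G.edge d = e) ∧
    ∀ d : Fin n, s.arr 4 d = bit01 (G.edge d ∈ c.edges)

end CombMap

/-! Write `k` for the number of terminals. For a set `T` of edges, the contour walk `tour T` follows
a dart of `T` along its face and steps across any other dart into the face behind it. On the sphere
`T` is a spanning tree exactly when this permutation is a single cycle on all darts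
(`sameCycle_tour_of_isSpanningTree`, `isSpanningTree_of_sameCycle_tour`); both directions rest on
homology modulo 2.

For a dart `d` off a spanning tree, the walk from `d` to `G.rev d` is an arc. The indicator of the
arc changes along the walk only at the edge of `d`, and since every mod 2 cycle on the sphere bounds
(`exists_faceBoundary_eq`), the arc consists of all darts of the faces on one side of the
fundamental cycle (`IsArc.exists_cycle`). Counting terminals on a side thus becomes counting marked
darts on an arc, three for each terminal.

If no arc were balanced, all arcs would be light, with fewer than `k / 4` terminals: in a
triangulation an arc consists of the three darts of the triangle behind `d` and at most two shorter
arcs, hence holds fewer than `1 + k / 2 ≤ 3 * k / 4` terminals (`IsArc.arcWeight_lt`). But an arc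
and its reverse together carry all terminals, a contradiction (`exists_balanced_arc`).

The algorithm numbers the darts along the walk and stores prefix sums of the marks, so that each arc
is weighed in constant time and the cycle is read off by comparing positions (`runs_separate`). When
no tree is given, the walk itself builds one: starting from all edges, an edge is deleted whenever
an unseen face lies behind it, so the deleted edges grow a spanning tree of the dual graph
(`WalkInv`, `runs_buildTree`). -/

open Relation

/-! ### Orbits of the combinatorial map and invariant functions on darts. -/

namespace CombMap

variable {D : Type*} (G : CombMap D)

theorem tail_rot (x : D) : G.tail (G.rot x) = G.tail x :=
  Quotient.sound ⟨-1, by simp⟩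

theorem face_facePerm (x : D) : G.face (G.facePerm x) = G.face x :=
  Quotient.sound ⟨-1, by simp⟩

theorem facePerm_apply (x : D) : G.facePerm x = G.rot (G.rev x) := rfl

theorem face_rot (x : D) : G.face (G.rot x) = G.face (G.rev x) := by
  rw [← G.face_facePerm (G.rev x), facePerm_apply, G.rev_rev]

theorem edge_rev (x : D) : G.edge (G.rev x) = G.edge x :=
  Quotient.sound ⟨-1, by simp⟩

theorem edge_eq_iff {x y : D} : G.edge x = G.edge y ↔ x = y ∨ x = G.rev y := by
  constructor
  · intro h
    obtain ⟨i, hi⟩ : G.rev.SameCycle x y := Quotient.exact h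
    have h2 : G.rev ^ (2 : ℤ) = 1 := by
      ext d; exact G.rev_rev d
    rcases Int.even_or_odd' i with ⟨k, rfl | rfl⟩
    · left; simpa [zpow_mul, h2] using hi
    · right; rw [zpow_add, zpow_mul, h2] at hi
      simp at hi; rw [← hi, G.rev_rev]
  · rintro (rfl | rfl)
    · rfl
    · exact G.edge_rev y

theorem edge_surjective (e : G.Edge) : ∃ x, G.edge x = e := Quotient.exists_rep e

/-- A function on darts that agrees on opposite darts descends to edges. -/
theorem exists_edge_fun {α : Type*} (g : D → α) (hg : ∀ x, g (G.rev x) = g x) :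
    ∃ z : G.Edge → α, ∀ x, z (G.edge x) = g x := by
  refine ⟨Quotient.lift g fun a b h => ?_, fun x => rfl⟩
  rcases G.edge_eq_iff.1 (Quotient.sound h : G.edge a = G.edge b) with rfl | rfl
  · rfl
  · exact hg b

/-- A function invariant under a permutation is constant on its orbits. -/
theorem eq_of_sameCycle {α : Type*} {σ : Equiv.Perm D} {g : D → α} (hg : ∀ x, g (σ x) = g x)
    {x y : D} (h : σ.SameCycle x y) : g x = g y := by
  obtain ⟨i, rfl⟩ := h
  have hn : ∀ (n : ℕ) z, g ((σ ^ n) z) = g z := by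
    intro n
    induction n with
    | zero => simp
    | succ n ih => intro z; rw [pow_succ', Equiv.Perm.mul_apply, hg, ih]
  cases i with
  | ofNat n => exact (hn n x).symm
  | negSucc n =>
    rw [zpow_negSucc]
    have := hn (n + 1) ((σ ^ (n + 1))⁻¹ x)
    rwa [← Equiv.Perm.mul_apply, mul_inv_cancel, Equiv.Perm.one_apply] at this

theorem eq_of_tail_eq {α : Type*} {g : D → α} (hg : ∀ x, g (G.rot x) = g x) {x y : D}
    (h : G.tail x = G.tail y) : g x = g y :=
  eq_of_sameCycle hg (Quotient.exact h)

theorem eq_of_face_eq {α : Type*} {g : D → α} (hg : ∀ x, g (G.facePerm x) = g x) {x y : D}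
    (h : G.face x = G.face y) : g x = g y :=
  eq_of_sameCycle hg (Quotient.exact h)

/-- A function of the darts that is constant around vertices and along the edges of a spanning
edge set is constant. -/
theorem eq_of_spans {α : Type*} {F : Set G.Edge} (hF : G.Spans F) {g : D → α}
    (hrot : ∀ x, g (G.rot x) = g x) (hrev : ∀ x, G.edge x ∈ F → g (G.rev x) = g x) (x y : D) :
    g x = g y := by
  have key : ∀ v, ReflTransGen (G.Step F) (G.tail x) v → ∀ y, G.tail y = v → g x = g y := by
    intro v hv
    induction hv with
    | refl => intro y hy; exact G.eq_of_tail_eq hrot hy.symm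
    | tail _ hs ih =>
      intro y hy
      obtain ⟨d, hd, rfl, h2⟩ := hs
      rw [ih d rfl, ← hrev d hd]
      exact G.eq_of_tail_eq hrot (h2.trans hy.symm)
  exact key _ (hF _ _) y rfl

/-! ### Homology modulo 2 of the sphere. -/

/-- The sum of the values of a function on the two sides of an edge. -/
noncomputable def coboundary (s : G.Face → ZMod 2) : G.Edge → ZMod 2 :=
  (G.exists_edge_fun (fun x => s (G.face x) + s (G.face (G.rev x)))
    fun x => by rw [G.rev_rev, add_comm]).choose

theorem coboundary_edge (s : G.Face → ZMod 2) (x : D) :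
    G.coboundary s (G.edge x) = s (G.face x) + s (G.face (G.rev x)) :=
  Exists.choose_spec (G.exists_edge_fun (fun x => s (G.face x) + s (G.face (G.rev x)))
    fun x => by rw [G.rev_rev, add_comm]) x

/-- The edges between a set of faces and its complement, modulo 2. -/
noncomputable def faceBoundary : (G.Face → ZMod 2) →ₗ[ZMod 2] (G.Edge → ZMod 2) where
  toFun := G.coboundary
  map_add' s t := by
    ext e
    obtain ⟨x, rfl⟩ := G.edge_surjective e
    simp only [coboundary_edge, Pi.add_apply]; ring
  map_smul' a s := by
    ext e
    obtain ⟨x, rfl⟩ := G.edge_surjective e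
    simp only [coboundary_edge, Pi.smul_apply, RingHom.id_apply, smul_add]

theorem faceBoundary_apply (s : G.Face → ZMod 2) (x : D) :
    G.faceBoundary s (G.edge x) = s (G.face x) + s (G.face (G.rev x)) :=
  G.coboundary_edge s x

section Chains

variable [Fintype D]

open Classical in
/-- The boundary modulo 2 of a set of edges. -/
noncomputable def boundary : (G.Edge → ZMod 2) →ₗ[ZMod 2] (G.Vertex → ZMod 2) where
  toFun z v := ∑ x, if G.tail x = v then z (G.edge x) else 0
  map_add' z w := by
    ext v; simp only [Pi.add_apply, ← Finset.sum_add_distrib]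
    exact Finset.sum_congr rfl fun x _ => by split_ifs <;> simp
  map_smul' a z := by
    ext v; simp only [Pi.smul_apply, Finset.smul_sum, RingHom.id_apply]
    exact Finset.sum_congr rfl fun x _ => by split_ifs <;> simp

open Classical in
theorem boundary_apply (z : G.Edge → ZMod 2) (v : G.Vertex) :
    G.boundary z v = ∑ x, if G.tail x = v then z (G.edge x) else 0 := rfl

/-- The changes of a function around a vertex cancel. -/
theorem boundary_eq_zero {z : G.Edge → ZMod 2} {g : D → ZMod 2}
    (h : ∀ x, z (G.edge x) = g x + g (G.rot x)) : G.boundary z = 0 := by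
  classical
  ext v
  have h1 : (∑ x, if G.tail x = v then g (G.rot x) else 0)
      = ∑ x, if G.tail x = v then g x else 0 := by
    rw [← Equiv.sum_comp G.rot (fun x => if G.tail x = v then g x else 0)]
    simp only [tail_rot]
  calc G.boundary z v = ∑ x, if G.tail x = v then z (G.edge x) else 0 := by
        rw [boundary_apply]
    _ = (∑ x, if G.tail x = v then g x else 0) + ∑ x, if G.tail x = v then g (G.rot x) else 0 := by
        rw [← Finset.sum_add_distrib]
        exact Finset.sum_congr rfl fun x _ => by split_ifs <;> simp [h]
    _ = 0 := by rw [h1]; exact CharTwo.add_self_eq_zero _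

theorem boundary_faceBoundary (s : G.Face → ZMod 2) : G.boundary (G.faceBoundary s) = 0 :=
  G.boundary_eq_zero (g := fun x => s (G.face x)) fun x => by
    rw [faceBoundary_apply, face_rot]

open Classical in
-- The edge has the two darts `x` and `G.rev x`, starting at its two ends. For a loop the two terms
-- coincide and cancel.
theorem boundary_single (x : D) :
    G.boundary (Pi.single (G.edge x) 1)
      = Pi.single (G.tail x) 1 + Pi.single (G.head x) 1 := by
  ext v
  have : ∀ y, (if G.tail y = v then (Pi.single (G.edge x) 1 : G.Edge → ZMod 2) (G.edge y) else 0)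
      = (if y = x then (if G.tail y = v then 1 else 0) else 0)
        + (if y = G.rev x then (if G.tail y = v then 1 else 0) else 0) := by
    intro y
    by_cases h1 : y = x
    · subst h1
      simp [(G.rev_ne y).symm]
    · by_cases h2 : y = G.rev x
      · subst h2; simp [G.rev_ne, G.edge_rev]
      · have : G.edge y ≠ G.edge x := fun h => (G.edge_eq_iff.1 h).elim h1 h2
        simp [h1, h2, this]
  rw [boundary_apply, Finset.sum_congr rfl fun y _ => this y, Finset.sum_add_distrib]
  simp [Pi.single_apply, head, eq_comm]

/-- By connectivity the boundaries of edges together with one vertex span all vertex chains, so the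
rank of `boundary` is at least the number of vertices minus 1. Euler's formula converts this into a
bound for the kernel. -/
theorem finrank_ker_boundary_le (hG : G.IsPlane) :
    (Module.finrank (ZMod 2) (LinearMap.ker G.boundary) : ℤ) ≤ Nat.card G.Face - 1 := by
  classical
  have : Fintype G.Vertex := Fintype.ofFinite _
  have : Fintype G.Edge := Fintype.ofFinite _
  have hE := hG.2
  have h1 := LinearMap.finrank_range_add_finrank_ker G.boundary
  rw [Module.finrank_fintype_fun_eq_card, ← Nat.card_eq_fintype_card] at h1
  suffices hV : Nat.card G.Vertex ≤ Module.finrank (ZMod 2) (LinearMap.range G.boundary) + 1 by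
    omega
  rcases isEmpty_or_nonempty G.Vertex with hv | ⟨⟨v₀⟩⟩
  · simp
  let P : Submodule (ZMod 2) (G.Vertex → ZMod 2) := Submodule.span (ZMod 2) {Pi.single v₀ 1}
  have hmem : ∀ v, (Pi.single v 1 : G.Vertex → ZMod 2) ∈ LinearMap.range G.boundary ⊔ P := by
    intro v
    have := hG.1 v₀ v
    induction this with
    | refl => exact Submodule.mem_sup_right (Submodule.mem_span_singleton_self _)
    | tail _ hs ih =>
      obtain ⟨d, -, rfl, rfl⟩ := hs
      have := Submodule.add_mem _ ih (Submodule.mem_sup_left (T := P)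
        (LinearMap.mem_range_self G.boundary (Pi.single (G.edge d) 1)))
      rwa [boundary_single, ← add_assoc, ZModModule.add_self, zero_add] at this
  have htop : LinearMap.range G.boundary ⊔ P = ⊤ := by
    rw [eq_top_iff, ← (Pi.basisFun (ZMod 2) G.Vertex).span_eq, Submodule.span_le]
    rintro _ ⟨v, rfl⟩
    simpa using hmem v
  have h2 := Submodule.finrank_add_le_finrank_add_finrank (LinearMap.range G.boundary) P
  rw [htop, finrank_top, Module.finrank_fintype_fun_eq_card, ← Nat.card_eq_fintype_card] at h2
  have h3 : Module.finrank (ZMod 2) P ≤ 1 := finrank_span_le_card _ |>.trans (by simp)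
  omega

/-- A face function without boundary agrees on both sides of every edge, so by connectivity it is
constant and the kernel has dimension at most 1. -/
theorem finrank_range_faceBoundary_ge (hG : G.IsPlane) :
    (Nat.card G.Face : ℤ) - 1 ≤ Module.finrank (ZMod 2) (LinearMap.range G.faceBoundary) := by
  classical
  have : Fintype G.Face := Fintype.ofFinite _
  have h1 := LinearMap.finrank_range_add_finrank_ker G.faceBoundary
  rw [Module.finrank_fintype_fun_eq_card, ← Nat.card_eq_fintype_card] at h1
  suffices Module.finrank (ZMod 2) (LinearMap.ker G.faceBoundary) ≤ 1 by omega
  refine finrank_le_one ⟨fun _ => 1, ?_⟩ ?_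
  · ext e
    obtain ⟨x, rfl⟩ := G.edge_surjective e
    rw [faceBoundary_apply]; exact CharTwo.add_self_eq_zero _
  · rintro ⟨s, hs⟩
    have hrev : ∀ x, s (G.face (G.rev x)) = s (G.face x) := by
      intro x
      have := congrFun (LinearMap.mem_ker.1 hs) (G.edge x)
      rw [faceBoundary_apply] at this
      exact (CharTwo.add_eq_zero.1 this).symm
    rcases isEmpty_or_nonempty D with hD | ⟨⟨x₀⟩⟩
    · refine ⟨0, Subtype.ext (funext fun f => ?_)⟩
      obtain ⟨x, -⟩ := Quotient.exists_rep f
      exact hD.elim x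
    · refine ⟨s (G.face x₀), Subtype.ext (funext fun f => ?_)⟩
      obtain ⟨x, rfl⟩ := Quotient.exists_rep f
      have := G.eq_of_spans hG.1 (g := fun x => s (G.face x))
        (fun x => by simp only [face_rot, hrev]) (fun x _ => hrev x) x₀ x
      simpa [face] using this

/-- On the sphere every cycle modulo 2 bounds a set of faces. -/
theorem exists_faceBoundary_eq (hG : G.IsPlane) {z : G.Edge → ZMod 2} (hz : G.boundary z = 0) :
    ∃ s, G.faceBoundary s = z := by
  have hle : LinearMap.range G.faceBoundary ≤ LinearMap.ker G.boundary := by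
    rintro _ ⟨s, rfl⟩
    exact G.boundary_faceBoundary s
  have h1 := G.finrank_ker_boundary_le hG
  have h2 := G.finrank_range_faceBoundary_ge hG
  -- Boundaries are cycles, and the two dimension bounds leave no room for other cycles.
  have := Submodule.eq_of_le_of_finrank_le hle (by omega)
  have hz' : z ∈ LinearMap.range G.faceBoundary := by rw [this]; exact hz
  exact hz'

/-- At the head of every edge of a cycle modulo 2 there is another edge of it. -/
theorem exists_next {z : G.Edge → ZMod 2} (hz : G.boundary z = 0) {x : D}
    (hx : z (G.edge x) ≠ 0) :
    ∃ y, z (G.edge y) ≠ 0 ∧ G.tail y = G.head x ∧ y ≠ G.rev x := by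
  classical
  by_contra! h
  have h0 : G.boundary z (G.head x) = 0 := by rw [hz]; rfl
  -- Otherwise `G.rev x` is the only dart at this vertex contributing to the boundary, which is then
  -- nonzero.
  rw [boundary_apply, Finset.sum_eq_single (G.rev x)] at h0
  · rw [if_pos (show G.tail (G.rev x) = G.head x from rfl), edge_rev] at h0
    exact hx h0
  · intro y _ hy
    split_ifs with ht
    · by_contra hzy
      exact hy (h y hzy ht)
    · rfl
  · simp

/-- A nonzero cycle modulo 2 contains a simple cycle. -/
theorem exists_simpleCycle {z : G.Edge → ZMod 2} (hz : G.boundary z = 0) (hne : z ≠ 0) :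
    ∃ c : G.SimpleCycle, ∀ e ∈ c.edges, z e ≠ 0 := by
  obtain ⟨e₀, he₀⟩ := Function.ne_iff.1 hne
  obtain ⟨x₀, rfl⟩ := G.edge_surjective e₀
  choose! next hn1 hn2 hn3 using fun x (hx : z (G.edge x) ≠ 0) => G.exists_next hz hx
  let w : ℕ → D := fun i => next^[i] x₀
  have hw : ∀ i, w (i + 1) = next (w i) := fun i => Function.iterate_succ_apply' next i x₀
  have hwz : ∀ i, z (G.edge (w i)) ≠ 0 := by
    intro i
    induction i with
    | zero => exact he₀
    | succ i ih => rw [hw]; exact hn1 _ ih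
  have hwt : ∀ i, G.head (w i) = G.tail (w (i + 1)) := fun i => by
    rw [hw]; exact (hn2 _ (hwz i)).symm
  -- A vertex recurs after `m + 1` steps of the walk. Taking `m` minimal over all starting times
  -- makes the vertices in between distinct.
  have hrep : ∃ m i, G.tail (w i) = G.tail (w (i + m + 1)) := by
    obtain ⟨i, j, hij, h⟩ := Finite.exists_ne_map_eq_of_infinite fun i => G.tail (w i)
    wlog hlt : i < j generalizing i j
    · exact this j i hij.symm h.symm (by omega)
    exact ⟨j - i - 1, i, by rw [show i + (j - i - 1) + 1 = j by omega]; exact h⟩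
  classical
  obtain ⟨i, hi⟩ := Nat.find_spec hrep
  set m := Nat.find hrep with hm
  have hinj : ∀ a b, a < b → b ≤ m → G.tail (w (i + a)) ≠ G.tail (w (i + b)) := by
    intro a b hab hb h
    refine Nat.find_min hrep (m := b - a - 1) (by omega) ⟨i + a, ?_⟩
    rw [show i + a + (b - a - 1) + 1 = i + b by omega]; exact h
  have hclosed : ∀ j : Fin (m + 1),
      G.tail (w (i + j + 1)) = G.tail (w (i + ((j + 1 : Fin (m + 1)) : ℕ))) := by
    intro j
    rw [Fin.val_add_one]
    split_ifs with h
    · rw [h]; simpa using hi.symm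
    · rw [add_assoc]
  refine ⟨⟨m, fun j => w (i + j), fun j => (hwt _).trans (hclosed j), ?_, ?_⟩, ?_⟩
  · intro a b h
    by_contra hab
    rcases lt_or_gt_of_ne (fun h => hab (Fin.ext h) : (a : ℕ) ≠ b) with hlt | hlt
    · exact hinj a b hlt (by omega) h
    · exact hinj b a hlt (by omega) h.symm
  · have key : ∀ a b : ℕ, a < b → b ≤ m → G.edge (w (i + a)) ≠ G.edge (w (i + b)) := by
      intro a b hab hb h
      rcases G.edge_eq_iff.1 h.symm with h | h
      · exact hinj a b hab hb (by rw [h])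
      -- An edge used again in the opposite direction forces `b = a + 1`, an immediate reversal,
      -- which the choice of `next` forbids.
      · have ht : G.tail (w (i + b)) = G.tail (w (i + (a + 1))) := by
          rw [h, ← add_assoc, ← hwt]; rfl
        have hb' : b = a + 1 := by
          by_contra hne
          exact hinj (a + 1) b (by omega) hb ht.symm
        rw [hb', ← add_assoc, hw] at h
        exact hn3 _ (hwz _) h
    intro a b h
    by_contra hab
    rcases lt_or_gt_of_ne (fun h => hab (Fin.ext h) : (a : ℕ) ≠ b) with hlt | hlt
    · exact key a b hlt (by omega) h
    · exact key b a hlt (by omega) h.symm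
  · rintro _ ⟨j, rfl⟩
    exact hwz _

open Classical in
-- Each vertex of the cycle is the tail of one dart and the head of the previous one, so it is
-- counted twice.
theorem boundary_indicator_simpleCycle (c : G.SimpleCycle) :
    G.boundary (fun e => if e ∈ c.edges then 1 else 0) = 0 := by
  have h1 : (fun e => if e ∈ c.edges then (1 : ZMod 2) else 0)
      = ∑ i, Pi.single (G.edge (c.dart i)) 1 := by
    ext e
    rw [Finset.sum_apply]
    split_ifs with he
    · obtain ⟨i, rfl⟩ := he
      rw [Finset.sum_eq_single i]
      · simp
      · intro j _ hj
        exact Pi.single_eq_of_ne (fun h => hj (c.edge_injective h.symm)) _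
      · simp
    · rw [Finset.sum_eq_zero]
      intro i _
      exact Pi.single_eq_of_ne (fun h => he ⟨i, h.symm⟩) _
  rw [h1, map_sum]
  simp only [boundary_single, c.closed, Finset.sum_add_distrib]
  have h2 := Equiv.sum_comp (Equiv.addRight (1 : Fin (c.len + 1)))
    (fun i => (Pi.single (G.tail (c.dart i)) 1 : G.Vertex → ZMod 2))
  simp only [Equiv.coe_addRight] at h2
  rw [h2]
  exact ZModModule.add_self _

end Chains

end CombMap

open Relation

/-! ### Arcs of a cyclic permutation. -/

section CyclicPerm

variable {D : Type*} {σ : Equiv.Perm D}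

/-- `x` is among the `L` elements that follow `d` under iteration of `σ`. -/
def InArc (σ : Equiv.Perm D) (d : D) (L : ℕ) (x : D) : Prop := ∃ t < L, (σ ^ (t + 1)) d = x

theorem inArc_end {d : D} {L : ℕ} (h0 : 0 < L) : InArc σ d L ((σ ^ L) d) :=
  ⟨L - 1, by omega, by rw [Nat.sub_add_cancel h0]⟩

/-- The total weight of the `L` elements that follow `d` under iteration of `σ`. -/
def arcWeight (σ : Equiv.Perm D) (w : D → ℕ) (d : D) (L : ℕ) : ℕ :=
  ∑ t ∈ Finset.range L, w ((σ ^ (t + 1)) d)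

theorem arcWeight_succ (w : D → ℕ) (d : D) (L : ℕ) :
    arcWeight σ w d (L + 1) = arcWeight σ w d L + w ((σ ^ (L + 1)) d) :=
  Finset.sum_range_succ _ _

theorem arcWeight_add (w : D → ℕ) (d : D) (p q : ℕ) :
    arcWeight σ w d (p + q) = arcWeight σ w d p + arcWeight σ w ((σ ^ p) d) q := by
  rw [arcWeight, Finset.sum_range_add]
  congr 1
  refine Finset.sum_congr rfl fun t _ => ?_
  rw [← Equiv.Perm.mul_apply, ← pow_add, show t + 1 + p = p + t + 1 by omega]

variable [Fintype D]

theorem isCycleOn_univ_of_sameCycle (hσ : ∀ x y, σ.SameCycle x y) :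
    σ.IsCycleOn ((Finset.univ : Finset D) : Set D) := by
  rw [Finset.coe_univ]
  exact ⟨Set.bijOn_univ.2 σ.bijective, fun x _ y _ => hσ x y⟩

theorem pow_card_of_sameCycle (hσ : ∀ x y, σ.SameCycle x y) (x : D) :
    (σ ^ Fintype.card D) x = x :=
  (isCycleOn_univ_of_sameCycle hσ).pow_card_apply (Finset.mem_univ x)

theorem exists_pow_of_sameCycle (hσ : ∀ x y, σ.SameCycle x y) (x y : D) :
    ∃ i < Fintype.card D, (σ ^ i) x = y :=
  (isCycleOn_univ_of_sameCycle hσ).exists_pow_eq (Finset.mem_univ x) (Finset.mem_univ y)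

theorem pow_inj_of_sameCycle (hσ : ∀ x y, σ.SameCycle x y) {x : D} {i j : ℕ}
    (hi : i < Fintype.card D) (hj : j < Fintype.card D) (h : (σ ^ i) x = (σ ^ j) x) : i = j :=
  Nat.ModEq.eq_of_lt_of_lt
    (((isCycleOn_univ_of_sameCycle hσ).pow_apply_eq_pow_apply (Finset.mem_univ x)).1 h) hi hj

theorem inArc_pow_iff (hσ : ∀ x y, σ.SameCycle x y) {d : D} {L t : ℕ} (hL : L < Fintype.card D)
    (ht : t < Fintype.card D) : InArc σ d L ((σ ^ t) d) ↔ 1 ≤ t ∧ t ≤ L := by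
  constructor
  · rintro ⟨r, hr, h⟩
    have := pow_inj_of_sameCycle hσ (by omega) ht h
    omega
  · rintro ⟨h1, h2⟩
    exact ⟨t - 1, by omega, by rw [Nat.sub_add_cancel h1]⟩

theorem not_inArc_self (hσ : ∀ x y, σ.SameCycle x y) {d : D} {L : ℕ}
    (hL : L < Fintype.card D) : ¬ InArc σ d L d := by
  have := inArc_pow_iff hσ (d := d) (t := 0) hL (by omega)
  simpa using this

/-- An arc is entered only on leaving `d` and left only after its last element; this is what makes
its indicator nearly invariant under `σ`. -/
theorem inArc_apply_iff (hσ : ∀ x y, σ.SameCycle x y) {d : D} {L : ℕ} (hL : L < Fintype.card D)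
    {x : D} (h1 : x ≠ d) (h2 : x ≠ (σ ^ L) d) : InArc σ d L (σ x) ↔ InArc σ d L x := by
  obtain ⟨t, ht, rfl⟩ := exists_pow_of_sameCycle hσ d x
  have ht0 : t ≠ 0 := by rintro rfl; simp at h1
  have htL : t ≠ L := by rintro rfl; exact h2 rfl
  rw [← Equiv.Perm.mul_apply, ← pow_succ', inArc_pow_iff hσ hL ht]
  rcases Nat.lt_or_ge (t + 1) (Fintype.card D) with h | h
  · rw [inArc_pow_iff hσ hL h]; omega
  · rw [show t + 1 = Fintype.card D by omega, pow_card_of_sameCycle hσ]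
    have := not_inArc_self hσ (d := d) hL
    simp only [this, false_iff]; omega

theorem not_inArc_apply_end (hσ : ∀ x y, σ.SameCycle x y) {d : D} {L : ℕ}
    (hL : L < Fintype.card D) : ¬ InArc σ d L (σ ((σ ^ L) d)) := by
  rw [← Equiv.Perm.mul_apply, ← pow_succ']
  rcases Nat.lt_or_ge (L + 1) (Fintype.card D) with h | h
  · rw [inArc_pow_iff hσ hL h]; omega
  · rw [show L + 1 = Fintype.card D by omega, pow_card_of_sameCycle hσ]
    exact not_inArc_self hσ hL

/-- Arcs omit their start and contain their end, so the two arcs between two points tile the whole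
cycle. -/
theorem inArc_compl_iff (hσ : ∀ x y, σ.SameCycle x y) {d : D} {L : ℕ} (hL : L < Fintype.card D)
    (x : D) : InArc σ ((σ ^ L) d) (Fintype.card D - L) x ↔ ¬ InArc σ d L x := by
  obtain ⟨t, ht, rfl⟩ := exists_pow_of_sameCycle hσ d x
  rw [inArc_pow_iff hσ hL ht]
  have hp : ∀ r, (σ ^ (r + 1)) ((σ ^ L) d) = (σ ^ (r + 1 + L)) d := fun r => by
    rw [← Equiv.Perm.mul_apply, ← pow_add]
  constructor
  · rintro ⟨r, hr, h⟩
    rw [hp] at h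
    rcases Nat.lt_or_ge (r + 1 + L) (Fintype.card D) with h' | h'
    · have := pow_inj_of_sameCycle hσ h' ht h; omega
    · rw [show r + 1 + L = Fintype.card D by omega, pow_card_of_sameCycle hσ] at h
      have := pow_inj_of_sameCycle hσ (i := 0) (by omega) ht (by simpa using h); omega
  · intro h
    rcases Nat.eq_zero_or_pos t with rfl | h0
    · refine ⟨Fintype.card D - L - 1, by omega, ?_⟩
      rw [hp, show Fintype.card D - L - 1 + 1 + L = Fintype.card D by omega,
        pow_card_of_sameCycle hσ]; simp
    · refine ⟨t - L - 1, by omega, ?_⟩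
      rw [hp, show t - L - 1 + 1 + L = t by omega]

open Classical in
theorem arcWeight_eq_sum (hσ : ∀ x y, σ.SameCycle x y) (w : D → ℕ) {d : D} {L : ℕ}
    (hL : L ≤ Fintype.card D) :
    arcWeight σ w d L = ∑ x, if InArc σ d L x then w x else 0 := by
  rw [← Finset.sum_filter, arcWeight]
  refine Finset.sum_bij (fun t _ => (σ ^ (t + 1)) d) ?_ ?_ ?_ fun _ _ => rfl
  · intro t ht
    exact Finset.mem_filter.2 ⟨Finset.mem_univ _, t, Finset.mem_range.1 ht, rfl⟩
  · intro a ha b hb h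
    rw [Finset.mem_range] at ha hb
    simp only [pow_succ', Equiv.Perm.mul_apply, EmbeddingLike.apply_eq_iff_eq] at h
    exact pow_inj_of_sameCycle hσ (by omega) (by omega) h
  · intro x hx
    obtain ⟨t, ht, h⟩ := (Finset.mem_filter.1 hx).2
    exact ⟨t, Finset.mem_range.2 ht, h⟩

theorem arcWeight_card (hσ : ∀ x y, σ.SameCycle x y) (w : D → ℕ) (d : D) :
    arcWeight σ w d (Fintype.card D) = ∑ x, w x := by
  classical
  rw [arcWeight_eq_sum hσ w le_rfl]
  refine Finset.sum_congr rfl fun x _ => if_pos ?_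
  obtain ⟨t, ht, rfl⟩ := exists_pow_of_sameCycle hσ d x
  rcases Nat.eq_zero_or_pos t with rfl | h0
  · exact ⟨Fintype.card D - 1, by omega, by
      rw [Nat.sub_add_cancel (by omega), pow_card_of_sameCycle hσ]; simp⟩
  · exact ⟨t - 1, by omega, by rw [Nat.sub_add_cancel h0]⟩

end CyclicPerm

/-! ### The contour walk and fundamental cycles. -/

namespace CombMap

variable {D : Type*} (G : CombMap D)

open Classical in
/-- Reverse the darts of the edges of `T` and fix all others. -/
noncomputable def revOn (T : Set G.Edge) : Equiv.Perm D :=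
  Function.Involutive.toPerm (fun x => if G.edge x ∈ T then G.rev x else x) fun x => by
    by_cases h : G.edge x ∈ T <;> simp [h, G.edge_rev, G.rev_rev]

/-- The contour walk around the subgraph `T`: it follows the darts in `T` and turns past
the others. -/
noncomputable def tour (T : Set G.Edge) : Equiv.Perm D := G.rot * G.revOn T

theorem tour_of_mem {T : Set G.Edge} {x : D} (h : G.edge x ∈ T) :
    G.tour T x = G.rot (G.rev x) := by
  rw [tour, Equiv.Perm.mul_apply]
  exact congrArg G.rot (if_pos h)

theorem tour_of_notMem {T : Set G.Edge} {x : D} (h : G.edge x ∉ T) : G.tour T x = G.rot x := by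
  rw [tour, Equiv.Perm.mul_apply]
  exact congrArg G.rot (if_neg h)

theorem face_tour_of_mem {T : Set G.Edge} {x : D} (h : G.edge x ∈ T) :
    G.face (G.tour T x) = G.face x := by
  rw [G.tour_of_mem h, face_rot, G.rev_rev]

theorem face_tour_of_notMem {T : Set G.Edge} {x : D} (h : G.edge x ∉ T) :
    G.face (G.tour T x) = G.face (G.rev x) := by
  rw [G.tour_of_notMem h, face_rot]

/-- The contour walk around a spanning tree visits all darts. -/
theorem sameCycle_tour_of_isSpanningTree [Finite D] {T : Set G.Edge} (hT : G.IsSpanningTree T)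
    (x₀ y₀ : D) : (G.tour T).SameCycle x₀ y₀ := by
  classical
  have : Fintype D := Fintype.ofFinite D
  let u : D → ZMod 2 := fun x => if (G.tour T).SameCycle x₀ x then 1 else 0
  have hu : ∀ x, u (G.tour T x) = u x := fun x => by
    simp only [u, Equiv.Perm.sameCycle_apply_right]
  -- `z` marks the tree edges whose two darts are distinguished by the orbit indicator `u`. It is
  -- the change of `u` under `rot`, hence a cycle modulo 2, and vanishes because the tree contains
  -- no simple cycle.
  obtain ⟨z, hz⟩ := G.exists_edge_fun (fun x => if G.edge x ∈ T then u x + u (G.rev x) else 0)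
    (fun x => by rw [G.edge_rev, G.rev_rev, add_comm])
  have hrot : ∀ x, u (G.rot x) = u x + z (G.edge x) := by
    intro x
    rw [hz]
    split_ifs with h
    · have := hu (G.rev x)
      rw [G.tour_of_mem (by rwa [G.edge_rev]), G.rev_rev] at this
      rw [this, ← add_assoc, CharTwo.add_self_eq_zero, zero_add]
    · have := hu x
      rw [G.tour_of_notMem h] at this
      rw [this, add_zero]
  have hb : G.boundary z = 0 := G.boundary_eq_zero (g := u) fun x => by
    rw [hrot, ← add_assoc, CharTwo.add_self_eq_zero, zero_add]
  have hz0 : z = 0 := by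
    by_contra hne
    obtain ⟨c, hc⟩ := G.exists_simpleCycle hb hne
    refine hT.2 c fun e he => ?_
    obtain ⟨x, rfl⟩ := G.edge_surjective e
    by_contra hx
    exact hc _ he (by rw [hz, if_neg hx])
  have key := G.eq_of_spans hT.1 (g := u) (fun x => by rw [hrot, hz0]; simp) (fun x hx => by
    have := hz x
    rw [hz0, if_pos hx] at this
    exact (CharTwo.add_eq_zero.1 this.symm).symm) x₀ y₀
  by_contra h
  simp [u, h, Equiv.Perm.SameCycle.refl] at key

/-- On the sphere, a set of edges whose contour walk visits all darts is a spanning tree. -/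
theorem isSpanningTree_of_sameCycle_tour [Finite D] (hG : G.IsPlane) {T : Set G.Edge}
    (hT : ∀ x y, (G.tour T).SameCycle x y) : G.IsSpanningTree T := by
  classical
  have : Fintype D := Fintype.ofFinite D
  constructor
  · intro v w
    obtain ⟨x, rfl⟩ := Quotient.exists_rep v
    obtain ⟨y, rfl⟩ := Quotient.exists_rep w
    obtain ⟨t, -, rfl⟩ := exists_pow_of_sameCycle hT x y
    change ReflTransGen (G.Step T) (G.tail x) (G.tail _)
    induction t with
    | zero => exact ReflTransGen.refl
    | succ t ih =>
      refine ih.trans ?_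
      rw [pow_succ', Equiv.Perm.mul_apply]
      by_cases h : G.edge (((G.tour T) ^ t) x) ∈ T
      · rw [G.tour_of_mem h]
        exact ReflTransGen.single ⟨_, h, rfl, (G.tail_rot _).symm⟩
      · rw [G.tour_of_notMem h, G.tail_rot]
  · intro c hc
    -- A cycle inside `T` bounds a set of faces. The walk crosses only edges off `T`, so it cannot
    -- leave this set, yet it visits both sides of the cycle.
    obtain ⟨s, hs⟩ := G.exists_faceBoundary_eq hG (G.boundary_indicator_simpleCycle c)
    have hs' : ∀ x, s (G.face (G.tour T x)) = s (G.face x) := by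
      intro x
      by_cases h : G.edge x ∈ T
      · rw [G.face_tour_of_mem h]
      · have := congrFun hs (G.edge x)
        rw [G.faceBoundary_apply, if_neg fun h' => h (hc h')] at this
        rw [G.face_tour_of_notMem h, CharTwo.add_eq_zero.1 this]
    have h0 := congrFun hs (G.edge (c.dart 0))
    rw [G.faceBoundary_apply, if_pos ⟨0, rfl⟩,
      eq_of_sameCycle (g := fun x => s (G.face x)) hs' (hT (c.dart 0) (G.rev (c.dart 0))),
      CharTwo.add_self_eq_zero] at h0
    exact zero_ne_one h0

/-- From the dart `d`, not in `T`, the contour walk around `T` takes `L` steps to the opposite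
dart. -/
structure IsArc [Fintype D] (T : Set G.Edge) (d : D) (L : ℕ) : Prop where
  notMem : G.edge d ∉ T
  lt_card : L < Fintype.card D
  pow_eq : (G.tour T ^ L) d = G.rev d

namespace IsArc

variable {G} [Fintype D] {T : Set G.Edge} {d : D} {L : ℕ}

theorem pos (h : G.IsArc T d L) : 0 < L := by
  rcases Nat.eq_zero_or_pos L with rfl | h0
  · exact absurd h.pow_eq.symm (by simpa using G.rev_ne d)
  · exact h0

theorem reverse (h : G.IsArc T d L) (hT : ∀ x y, (G.tour T).SameCycle x y) :
    G.IsArc T (G.rev d) (Fintype.card D - L) where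
  notMem := by rw [G.edge_rev]; exact h.notMem
  lt_card := by have := h.pos; have := h.lt_card; omega
  pow_eq := by
    rw [← h.pow_eq, ← Equiv.Perm.mul_apply, ← pow_add, Nat.sub_add_cancel h.lt_card.le,
      pow_card_of_sameCycle hT, h.pow_eq, G.rev_rev]

theorem apply_iff (h : G.IsArc T d L) (hT : ∀ x y, (G.tour T).SameCycle x y) {x : D}
    (hx : G.edge x ≠ G.edge d) :
    InArc (G.tour T) d L (G.tour T x) ↔ InArc (G.tour T) d L x :=
  inArc_apply_iff hT h.lt_card (fun hd => hx (by rw [hd]))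
    fun hd => hx (by rw [hd, h.pow_eq, G.edge_rev])

/-- Consecutive darts of the arc lie on the same face or on two faces separated by an edge off `T`.
That edge is not the one of `d`, whose darts are met only at times `0` and `L`. -/
theorem reflTransGen (h : G.IsArc T d L) (hT : ∀ x y, (G.tour T).SameCycle x y) {F : Set G.Edge}
    (hF : F ⊆ insert (G.edge d) T) {x y : D} (hx : InArc (G.tour T) d L x)
    (hy : InArc (G.tour T) d L y) : ReflTransGen (G.DualStep F) (G.face x) (G.face y) := by
  have hsymm : Std.Symm (G.DualStep F) := by
    constructor
    rintro _ _ ⟨e, he, rfl, rfl⟩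
    exact ⟨G.rev e, by rwa [G.edge_rev], rfl, by rw [G.rev_rev]⟩
  have key : ∀ t < L, ReflTransGen (G.DualStep F) (G.face (G.tour T d))
      (G.face ((G.tour T ^ (t + 1)) d)) := by
    intro t
    induction t with
    | zero => intro _; simpa using ReflTransGen.refl
    | succ t ih =>
      intro ht
      refine (ih (by omega)).trans ?_
      rw [pow_succ' _ (t + 1), Equiv.Perm.mul_apply]
      set e := (G.tour T ^ (t + 1)) d with he
      by_cases heT : G.edge e ∈ T
      · rw [G.face_tour_of_mem heT]
      · rw [G.face_tour_of_notMem heT]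
        refine ReflTransGen.single ⟨e, fun heF => ?_, rfl, rfl⟩
        rcases hF heF with h' | h'
        · have := h.lt_card
          rcases G.edge_eq_iff.1 h' with h'' | h''
          · have := pow_inj_of_sameCycle hT (i := t + 1) (j := 0) (x := d) (by omega) (by omega)
              (by rw [← he, h'']; simp)
            omega
          · have := pow_inj_of_sameCycle hT (i := t + 1) (j := L) (x := d) (by omega) (by omega)
              (by rw [← he, h'', h.pow_eq])
            omega
        · exact heT h'
  obtain ⟨i, hi, rfl⟩ := hx
  obtain ⟨j, hj, rfl⟩ := hy
  exact (ReflTransGen.stdSymm.symm _ _ (key i hi)).trans (key j hj)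

/-- The darts on an arc are the darts of the faces on one side of a fundamental cycle. -/
theorem exists_cycle (h : G.IsArc T d L) (hG : G.IsPlane)
    (hT : ∀ x y, (G.tour T).SameCycle x y) :
    ∃ (S : Set G.Face) (c : G.SimpleCycle), G.IsFundamentalCycle T (G.edge d) c ∧
      (∀ x, G.face x ∈ S ↔ InArc (G.tour T) d L x) ∧
      (∀ x, G.edge x ∈ c.edges ↔
        ¬ (InArc (G.tour T) d L x ↔ InArc (G.tour T) d L (G.rev x))) ∧
      ∀ infinite, G.exterior infinite c = S ∨ G.exterior infinite c = Sᶜ := by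
  classical
  let U : D → ZMod 2 := fun x => if InArc (G.tour T) d L x then 1 else 0
  have hUd : U d = 0 := if_neg (not_inArc_self hT h.lt_card)
  have hUr : U (G.rev d) = 1 := if_pos (by rw [← h.pow_eq]; exact inArc_end h.pos)
  have hUtd : U (G.tour T d) = 1 := if_pos ⟨0, h.pos, by simp⟩
  have hUtr : U (G.tour T (G.rev d)) = 0 :=
    if_neg (by rw [← h.pow_eq]; exact not_inArc_apply_end hT h.lt_card)
  have hU : ∀ x, G.edge x ≠ G.edge d → U (G.tour T x) = U x := fun x hx => by
    simp only [U, h.apply_iff hT hx]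
  have hUe : ∀ x, G.edge x = G.edge d → U x + U (G.tour T x) = 1 := by
    intro x hx
    rcases G.edge_eq_iff.1 hx with rfl | rfl
    · rw [hUd, hUtd, zero_add]
    · rw [hUr, hUtr, add_zero]
  have hUne : ∀ x, G.edge x ≠ G.edge d → U x + U (G.tour T x) = 0 := fun x hx => by
    rw [hU x hx, CharTwo.add_self_eq_zero]
  have hTne : ∀ x, G.edge x ∈ T → G.edge x ≠ G.edge d := fun x hx he =>
    h.notMem (by rwa [← he])
  -- A set of faces whose boundary meets the complement of `T` in the edge of `d` is this side.
  have side : ∀ (z : G.Edge → ZMod 2), G.boundary z = 0 →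
      (∀ x, G.edge x ∉ T → z (G.edge x) = U x + U (G.tour T x)) →
      ∃ (s : G.Face → ZMod 2), (∀ x, U x = s (G.face x)) ∧
        ∀ x, z (G.edge x) = U x + U (G.rev x) := by
    intro z hz hzT
    obtain ⟨s, hs⟩ := G.exists_faceBoundary_eq hG hz
    -- When the walk crosses an edge off `T`, both `U` and `s` change by `z`; so their sum is
    -- constant along the walk.
    have hinv : ∀ x, U (G.tour T x) + s (G.face (G.tour T x)) = U x + s (G.face x) := by
      intro x
      by_cases hx : G.edge x ∈ T
      · rw [G.face_tour_of_mem hx, hU x (hTne x hx)]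
      · have := hzT x hx
        rw [← hs, G.faceBoundary_apply] at this
        rw [G.face_tour_of_notMem hx]
        have h2 : U (G.tour T x) = U x + (s (G.face x) + s (G.face (G.rev x))) := by
          rw [this, ← add_assoc, CharTwo.add_self_eq_zero, zero_add]
        rw [h2]
        have := CharTwo.add_self_eq_zero (s (G.face (G.rev x)))
        linear_combination this
    have hc : ∀ x, U x = s (G.face x) + (U d + s (G.face d)) := by
      intro x
      rw [eq_of_sameCycle (g := fun x => U x + s (G.face x)) hinv (hT d x)]
      have := CharTwo.add_self_eq_zero (s (G.face x))
      linear_combination -this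
    refine ⟨fun f => s f + (U d + s (G.face d)), hc, fun x => ?_⟩
    rw [← hs, G.faceBoundary_apply, hc x, hc (G.rev x)]
    have := CharTwo.add_self_eq_zero (U d + s (G.face d))
    linear_combination -this
  -- This `z` equals the change of `U` under `rot` at every dart, so it has no boundary; off `T` it
  -- is supported on the edge of `d`.
  obtain ⟨z, hz⟩ := G.exists_edge_fun
    (fun x => if G.edge x ∈ T then U x + U (G.rev x) else U x + U (G.tour T x)) (fun x => by
      rw [G.edge_rev, G.rev_rev]
      split_ifs with hx
      · rw [add_comm]
      · by_cases he : G.edge x = G.edge d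
        · rw [hUe x he, hUe _ (by rwa [G.edge_rev])]
        · rw [hUne x he, hUne _ (by rwa [G.edge_rev])])
  have hb : G.boundary z = 0 := G.boundary_eq_zero (g := U) fun x => by
    rw [hz]
    split_ifs with hx
    · have := hU (G.rev x) (by rw [G.edge_rev]; exact hTne x hx)
      rw [G.tour_of_mem (by rwa [G.edge_rev]), G.rev_rev] at this
      rw [this]
    · rw [G.tour_of_notMem hx]
  obtain ⟨s, hs, hzU⟩ := side z hb fun x hx => by rw [hz, if_neg hx]
  have hz1 : z (G.edge d) = 1 := by rw [hzU, hUd, hUr, zero_add]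
  obtain ⟨c, hc⟩ := G.exists_simpleCycle hb fun h0 => by
    rw [h0] at hz1; exact zero_ne_one hz1
  have hcT : c.edges ⊆ insert (G.edge d) T := by
    intro e he
    obtain ⟨x, rfl⟩ := G.edge_surjective e
    by_contra hx
    rw [Set.mem_insert_iff, not_or] at hx
    exact hc _ he (by rw [hz, if_neg hx.2, hUne x hx.1])
  have hcb := G.boundary_indicator_simpleCycle c
  have hcd : G.edge d ∈ c.edges := by
    by_contra hd
    refine (G.isSpanningTree_of_sameCycle_tour hG hT).2 c fun e he => ?_
    rcases hcT he with rfl | he'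
    · exact absurd he hd
    · exact he'
  -- Off `T` the indicator of `c` also is that of the edge of `d`, so `side` applies again and shows
  -- that `c` is the entire frontier of the arc.
  obtain ⟨-, -, hcU⟩ := side _ hcb fun x hx => by
    by_cases he : G.edge x = G.edge d
    · rw [hUe x he, he, if_pos hcd]
    · rw [hUne x he, if_neg]
      intro hxc
      rcases hcT hxc with h' | h'
      · exact he h'
      · exact hx h'
  have hedge : ∀ x, G.edge x ∈ c.edges ↔
      ¬ (InArc (G.tour T) d L x ↔ InArc (G.tour T) d L (G.rev x)) := by
    intro x
    have := hcU x
    by_cases h1 : InArc (G.tour T) d L x <;> by_cases h2 : InArc (G.tour T) d L (G.rev x) <;>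
      by_cases h3 : G.edge x ∈ c.edges <;> simp [U, h1, h2, h3] at this ⊢
  have hS : ∀ x, G.face x ∈ {f | s f = 1} ↔ InArc (G.tour T) d L x := by
    intro x
    rw [Set.mem_ofPred_eq, ← hs]
    simp [U]
  refine ⟨{f | s f = 1}, c, ⟨h.notMem, hcd, hcT⟩, hS, hedge, fun infinite => ?_⟩
  have hstep : ∀ f g, ReflTransGen (G.DualStep c.edges) f g → (s f = 1 ↔ s g = 1) := by
    intro f g hfg
    induction hfg with
    | refl => rfl
    | tail _ hst ih =>
      obtain ⟨x, hx, rfl, rfl⟩ := hst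
      rw [hedge, not_not] at hx
      exact ih.trans ((hS x).trans (hx.trans (hS _).symm))
  obtain ⟨x₀, rfl⟩ := Quotient.exists_rep infinite
  by_cases hi : InArc (G.tour T) d L x₀
  · left
    ext f
    obtain ⟨y, rfl⟩ := Quotient.exists_rep f
    exact ⟨fun hf => (hstep _ _ hf).1 ((hS x₀).2 hi),
      fun hf => h.reflTransGen hT hcT hi ((hS y).1 hf)⟩
  · right
    ext f
    obtain ⟨y, rfl⟩ := Quotient.exists_rep f
    refine ⟨fun hf hy => hi ((hS x₀).1 ((hstep _ _ hf).2 hy)), fun hf => ?_⟩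
    have hcompl := fun x => inArc_compl_iff hT (d := d) h.lt_card x
    rw [h.pow_eq] at hcompl
    exact (h.reverse hT).reflTransGen hT (by rwa [G.edge_rev]) ((hcompl _).2 hi)
      ((hcompl _).2 fun hy => hf ((hS y).2 hy))

end IsArc

end CombMap

open Relation

/-! ### Triangulations and the existence of a balanced arc. -/

namespace CombMap

variable {D : Type*} {G : CombMap D}

theorem isCycleOn_face [Fintype D] (f : G.Face) :
    G.facePerm.IsCycleOn (({d | G.face d = f} : Set D).toFinite.toFinset : Set D) := by
  rw [Set.Finite.coe_toFinset]
  refine ⟨⟨fun x hx => ?_, G.facePerm.injective.injOn, fun x hx => ?_⟩, ?_⟩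
  · exact (G.face_facePerm x).trans hx
  · refine ⟨G.facePerm⁻¹ x, ?_, by simp⟩
    have := G.face_facePerm (G.facePerm⁻¹ x)
    rw [← Equiv.Perm.mul_apply, mul_inv_cancel, Equiv.Perm.one_apply] at this
    exact this.symm.trans hx
  · intro x hx y hy
    exact Quotient.exact (hx.trans hy.symm : G.face x = G.face y)

theorem IsTriangulated.pow_eq_iff [Fintype D] (h : G.IsTriangulated) (x : D) (n : ℕ) :
    (G.facePerm ^ n) x = x ↔ 3 ∣ n := by
  rw [(isCycleOn_face (G.face x)).pow_apply_eq (by simp), ← Set.ncard_eq_toFinset_card, h]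

theorem IsTriangulated.facePerm_cube [Fintype D] (h : G.IsTriangulated) (x : D) :
    G.facePerm (G.facePerm (G.facePerm x)) = x :=
  (h.pow_eq_iff x 3).2 dvd_rfl

theorem IsTriangulated.facePerm_ne [Fintype D] (h : G.IsTriangulated) (x : D) :
    G.facePerm x ≠ x := fun hx => by
  have := (h.pow_eq_iff x 1).1 hx
  omega

theorem IsTriangulated.facePerm_facePerm_ne [Fintype D] (h : G.IsTriangulated) (x : D) :
    G.facePerm (G.facePerm x) ≠ x := fun hx => by
  have := (h.pow_eq_iff x 2).1 hx
  omega

theorem IsTriangulated.face_eq_iff [Fintype D] (h : G.IsTriangulated) {x y : D} :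
    G.face y = G.face x ↔ y = x ∨ y = G.facePerm x ∨ y = G.facePerm (G.facePerm x) := by
  constructor
  · intro hy
    obtain ⟨n, hn, rfl⟩ := (isCycleOn_face (G.face x)).exists_pow_eq (a := x) (b := y)
      (by simp) (by simpa using hy)
    rw [← Set.ncard_eq_toFinset_card, h] at hn
    interval_cases n
    · exact Or.inl rfl
    · exact Or.inr (Or.inl rfl)
    · exact Or.inr (Or.inr rfl)
  · rintro (rfl | rfl | rfl) <;> simp [face_facePerm]

theorem bit01_of {p : Prop} (h : p) : bit01 p = 1 := if_pos h

theorem bit01_of_not {p : Prop} (h : ¬ p) : bit01 p = 0 := if_neg h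

theorem bit01_le (p : Prop) : bit01 p ≤ 1 := by
  unfold bit01; split_ifs <;> simp

/-- Every face has three darts: this is the source of the factor 3 in all later weights. -/
theorem IsTriangulated.sum_bit01 [Fintype D] (h : G.IsTriangulated) (Y : Set G.Face) :
    ∑ x, bit01 (G.face x ∈ Y) = 3 * Y.ncard := by
  classical
  have : Fintype G.Face := Fintype.ofFinite _
  have h1 : ∑ x, bit01 (G.face x ∈ Y) = (Finset.univ.filter fun x => G.face x ∈ Y).card := by
    rw [Finset.card_filter]
    exact Finset.sum_congr rfl fun x _ => by unfold bit01; congr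
  rw [h1, Finset.card_eq_sum_card_fiberwise (f := G.face) (t := Y.toFinset)
    (by intro x hx; simpa using hx), Finset.sum_const_nat (m := 3), mul_comm,
    Set.ncard_eq_toFinset_card']
  intro f hf
  rw [← h f, Set.ncard_eq_toFinset_card']
  congr 1
  ext x
  simp only [Finset.mem_filter, Finset.mem_univ, true_and, Set.mem_toFinset,
    Set.mem_ofPred_eq] at hf ⊢
  exact ⟨fun hx => hx.2, fun hx => ⟨by rwa [hx], hx⟩⟩

namespace IsArc

variable [Fintype D] {T : Set G.Edge} {d : D} {L : ℕ}

/-- The weight of an arc, when every dart of a terminal face has weight 1. -/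
theorem arcWeight_eq (h : G.IsArc T d L) (hT : ∀ x y, (G.tour T).SameCycle x y)
    (htri : G.IsTriangulated) {S : Set G.Face} (hS : ∀ x, G.face x ∈ S ↔ InArc (G.tour T) d L x)
    (X : Set G.Face) :
    arcWeight (G.tour T) (fun x => bit01 (G.face x ∈ X)) d L = 3 * (X ∩ S).ncard := by
  classical
  rw [arcWeight_eq_sum hT _ h.lt_card.le, ← htri.sum_bit01]
  refine Finset.sum_congr rfl fun x _ => ?_
  split_ifs with hx
  · have : G.face x ∈ X ∩ S ↔ G.face x ∈ X := ⟨fun h => h.1, fun h => ⟨h, (hS x).2 hx⟩⟩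
    rw [this]
  · exact (bit01_of_not fun h => hx ((hS x).1 h.2)).symm

/-- An arc whose weight is a balanced part of the total gives a balanced fundamental cycle. -/
theorem exists_isBalanced (h : G.IsArc T d L) (hG : G.IsPlane) (htri : G.IsTriangulated)
    (hT : ∀ x y, (G.tour T).SameCycle x y) (infinite : G.Face) (X : Set G.Face)
    (h1 : 3 * X.ncard ≤ 4 * arcWeight (G.tour T) (fun x => bit01 (G.face x ∈ X)) d L)
    (h2 : 4 * arcWeight (G.tour T) (fun x => bit01 (G.face x ∈ X)) d L ≤ 3 * (3 * X.ncard)) :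
    ∃ c : G.SimpleCycle, G.IsFundamentalCycle T (G.edge d) c ∧ G.IsBalanced infinite X c ∧
      ∀ x, G.edge x ∈ c.edges ↔
        ¬ (InArc (G.tour T) d L x ↔ InArc (G.tour T) d L (G.rev x)) := by
  obtain ⟨S, c, hc, hS, hedge, hext⟩ := h.exists_cycle hG hT
  refine ⟨c, hc, ?_, hedge⟩
  rw [h.arcWeight_eq hT htri hS] at h1 h2
  have hsum := Set.ncard_inter_add_ncard_sdiff_eq_ncard X S (Set.toFinite _)
  rw [Set.sdiff_eq] at hsum
  -- The weight is three times the number of terminals in `S`, so its two bounds limit `S` and its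
  -- complement respectively.
  have h1' : (4 * (X ∩ S).ncard : ℝ) ≤ 3 * X.ncard := by exact_mod_cast (by omega)
  have h2' : (4 * (X ∩ Sᶜ).ncard : ℝ) ≤ 3 * X.ncard := by exact_mod_cast (by omega)
  unfold IsBalanced interior
  rcases hext infinite with h' | h' <;> rw [h']
  · constructor <;> linarith
  · rw [compl_compl]; constructor <;> linarith

/-- Along an arc from `d`, a dart `x` of the last face is followed, possibly after the arc of `x`,
by the next dart of that face. -/
theorem exists_next_in_face (h : G.IsArc T d L) (hG : G.IsPlane)
    (hT : ∀ x y, (G.tour T).SameCycle x y) {o : ℕ} (ho : 1 ≤ o) (hoL : o < L) {x : D}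
    (hx : (G.tour T ^ o) d = x) (hf : G.face x = G.face (G.rev d)) :
    ∃ l, o + l + 1 ≤ L ∧ (G.tour T ^ (o + l + 1)) d = G.facePerm x ∧
      (l = 0 ∨ G.IsArc T x l) := by
  obtain ⟨S, c, hc, hS, hedge, -⟩ := h.exists_cycle hG hT
  have hlt := h.lt_card
  have hin : ∀ t < Fintype.card D, (InArc (G.tour T) d L ((G.tour T ^ t) d) ↔ 1 ≤ t ∧ t ≤ L) :=
    fun t ht => inArc_pow_iff hT hlt ht
  by_cases hxT : G.edge x ∈ T
  · refine ⟨0, by omega, ?_, Or.inl rfl⟩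
    rw [add_zero, pow_succ', Equiv.Perm.mul_apply, hx, G.tour_of_mem hxT, facePerm_apply]
  · have hxd : G.edge x ≠ G.edge d := by
      intro he
      rcases G.edge_eq_iff.1 he with rfl | rfl
      · have := pow_inj_of_sameCycle hT (i := o) (j := 0) (x := x) (by omega) (by omega)
          (by rw [hx]; simp)
        omega
      · have := pow_inj_of_sameCycle hT (by omega) hlt (hx.trans h.pow_eq.symm)
        omega
    -- The edge of `x` is not on the fundamental cycle, so `G.rev x` lies on the same arc, and after
    -- it the walk turns to the next dart of the face.
    have hxc : G.edge x ∉ c.edges := fun hxc => (hc.2.2 hxc).elim hxd hxT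
    rw [hedge, not_not] at hxc
    have hxin : InArc (G.tour T) d L x := by
      rw [← hx, hin o (by omega)]; omega
    have hrin : InArc (G.tour T) d L (G.rev x) := hxc.1 hxin
    obtain ⟨p, hp, hpx⟩ := exists_pow_of_sameCycle hT d (G.rev x)
    have hpL := (hin p hp).1 (by rwa [hpx])
    have hpne : p ≠ L := by
      rintro rfl
      rw [h.pow_eq] at hpx
      exact hxd (by rw [G.rev.injective hpx])
    have hnext : (G.tour T ^ (p + 1)) d = G.facePerm x := by
      rw [pow_succ', Equiv.Perm.mul_apply, hpx, G.tour_of_notMem (by rwa [G.edge_rev]),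
        facePerm_apply]
    -- If `G.rev x` came before `x`, the arc between them would contain the face of `x` entirely,
    -- hence `G.rev d`, which is reached only at time `L > o`.
    have hpo : o < p := by
      by_contra hle
      have hpo : p ≠ o := by
        rintro rfl
        exact G.rev_ne x (hpx.symm.trans hx)
      have harc : G.IsArc T (G.rev x) (o - p) := ⟨by rwa [G.edge_rev], by omega, by
        rw [← hpx, ← Equiv.Perm.mul_apply, ← pow_add, Nat.sub_add_cancel (by omega), hx, hpx,
          G.rev_rev]⟩
      obtain ⟨S', c', -, hS', -, -⟩ := harc.exists_cycle hG hT
      have hx' : G.face x ∈ S' := (hS' x).2 (by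
        have := inArc_end (σ := G.tour T) harc.pos (d := G.rev x)
        rwa [harc.pow_eq, G.rev_rev] at this)
      rw [hf, hS'] at hx'
      obtain ⟨t, ht, hte⟩ := hx'
      rw [← hpx, ← Equiv.Perm.mul_apply, ← pow_add, ← h.pow_eq] at hte
      have := pow_inj_of_sameCycle hT (by omega) hlt hte
      omega
    refine ⟨p - o, by omega, ?_, Or.inr ⟨hxT, by omega, ?_⟩⟩
    · rw [show o + (p - o) + 1 = p + 1 by omega, hnext]
    · rw [← hx, ← Equiv.Perm.mul_apply, ← pow_add, Nat.sub_add_cancel hpo.le, hpx, hx]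

/-- If no arc is balanced, all arcs are light. -/
theorem arcWeight_lt (hG : G.IsPlane) (htri : G.IsTriangulated)
    (hT : ∀ x y, (G.tour T).SameCycle x y) {X : Set G.Face} (hX : 4 ≤ X.ncard)
    (hno : ∀ d L, G.IsArc T d L →
      4 * arcWeight (G.tour T) (fun x => bit01 (G.face x ∈ X)) d L < 3 * X.ncard ∨
      3 * (3 * X.ncard) < 4 * arcWeight (G.tour T) (fun x => bit01 (G.face x ∈ X)) d L) :
    ∀ L d, G.IsArc T d L →
      4 * arcWeight (G.tour T) (fun x => bit01 (G.face x ∈ X)) d L < 3 * X.ncard := by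
  intro L
  induction L using Nat.strong_induction_on with
  | _ L ih =>
  intro d h
  have hlt := h.lt_card
  have hpos := h.pos
  set w : D → ℕ := fun x => bit01 (G.face x ∈ X) with hw
  have hw1 : ∀ x, w x ≤ 1 := fun x => bit01_le _
  -- The triangle behind `d` has the darts `a`, `b`, `G.rev d`, met in this order; the walk enters
  -- it at `a`, and the arc ends at `G.rev d`.
  set a := G.facePerm (G.rev d) with ha
  have had : G.tour T d = a := by
    rw [G.tour_of_notMem h.notMem, ha, facePerm_apply, G.rev_rev]
  have hL1 : 1 ≠ L := by
    rintro rfl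
    have := h.pow_eq
    rw [pow_one, had] at this
    exact htri.facePerm_ne _ this
  have hfa : G.face a = G.face (G.rev d) := G.face_facePerm _
  obtain ⟨la, hla, hla', hla2⟩ :=
    h.exists_next_in_face hG hT le_rfl (by omega) (by rw [pow_one, had]) hfa
  set b := G.facePerm a with hb
  have hfb : G.face b = G.face (G.rev d) := (G.face_facePerm _).trans hfa
  have hbL : 1 + la + 1 ≠ L := by
    intro h'
    rw [h', h.pow_eq] at hla'
    exact htri.facePerm_facePerm_ne _ hla'.symm
  obtain ⟨lb, hlb, hlb', hlb2⟩ := h.exists_next_in_face hG hT (by omega) (by omega) hla' hfb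
  rw [hb, ha, htri.facePerm_cube, ← h.pow_eq] at hlb'
  have hLeq := pow_inj_of_sameCycle hT (by omega) hlt hlb'
  have hwa : 4 * arcWeight (G.tour T) w a la < 3 * X.ncard := by
    rcases hla2 with rfl | h'
    · simp [arcWeight]; omega
    · exact ih la (by omega) a h'
  have hwb : 4 * arcWeight (G.tour T) w b lb < 3 * X.ncard := by
    rcases hlb2 with rfl | h'
    · simp [arcWeight]; omega
    · exact ih lb (by omega) b h'
  have hsum : arcWeight (G.tour T) w d L ≤
      3 + arcWeight (G.tour T) w a la + arcWeight (G.tour T) w b lb := by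
    rw [← hLeq, arcWeight_succ, arcWeight_add, hla', arcWeight_succ, arcWeight_add, pow_one, had]
    have h1 : arcWeight (G.tour T) w d 1 ≤ 1 := by
      simpa [arcWeight] using hw1 _
    have h2 := hw1 ((G.tour T ^ (1 + la + 1)) d)
    have h3 := hw1 ((G.tour T ^ (1 + la + 1 + lb + 1)) d)
    omega
  -- Here `4 * w < 12 + 6 * k ≤ 9 * k`, the last step being exactly `k ≥ 4`; so the arc is not
  -- heavy.
  rcases hno d L h with h' | h' <;> omega

end IsArc

/-- An arc and its reverse tile the walk, so they cannot both be light. An edge off `T` exists,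
since otherwise the walk stays on one face and there is at most one terminal. -/
theorem exists_balanced_arc [Fintype D] {T : Set G.Edge} (hG : G.IsPlane)
    (htri : G.IsTriangulated) (hT : ∀ x y, (G.tour T).SameCycle x y) {X : Set G.Face}
    (hX : 4 ≤ X.ncard) :
    ∃ d L, G.IsArc T d L ∧
      3 * X.ncard ≤ 4 * arcWeight (G.tour T) (fun x => bit01 (G.face x ∈ X)) d L ∧
      4 * arcWeight (G.tour T) (fun x => bit01 (G.face x ∈ X)) d L ≤ 3 * (3 * X.ncard) := by
  by_contra hno
  push Not at hno
  have hlight := IsArc.arcWeight_lt hG htri hT hX fun d L h => by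
    by_contra! h'
    exact absurd (hno d L h h'.1) (by omega)
  by_cases hall : ∀ d, G.edge d ∈ T
  · have hone : ∀ f g : G.Face, f = g := by
      intro f g
      obtain ⟨x, rfl⟩ := Quotient.exists_rep f
      obtain ⟨y, rfl⟩ := Quotient.exists_rep g
      exact eq_of_sameCycle (g := G.face) (fun x => G.face_tour_of_mem (hall x)) (hT x y)
    have := (Set.ncard_le_one X.toFinite).2 fun a _ b _ => hone a b
    omega
  · push Not at hall
    obtain ⟨d, hd⟩ := hall
    obtain ⟨L, hL, hLd⟩ := exists_pow_of_sameCycle hT d (G.rev d)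
    have harc : G.IsArc T d L := ⟨hd, hL, hLd⟩
    have h1 := hlight L d harc
    have h2 := hlight _ _ (harc.reverse hT)
    have h3 := arcWeight_add (σ := G.tour T) (fun x => bit01 (G.face x ∈ X)) d L
      (Fintype.card D - L)
    rw [Nat.add_sub_cancel' hL.le, arcWeight_card hT, htri.sum_bit01, hLd] at h3
    omega

/-- Every spanning tree has a balanced fundamental cycle. -/
theorem exists_balanced_fundamentalCycle [Finite D] (infinite : G.Face) (X : Set G.Face)
    (T : Set G.Edge) (hG : G.IsPlane) (htri : G.IsTriangulated) (hX : 4 ≤ X.ncard)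
    (hT : G.IsSpanningTree T) :
    ∃ (e : G.Edge) (c : G.SimpleCycle),
      G.IsFundamentalCycle T e c ∧ G.IsBalanced infinite X c := by
  have : Fintype D := Fintype.ofFinite D
  have hT' := G.sameCycle_tour_of_isSpanningTree hT
  obtain ⟨d, L, h, h1, h2⟩ := exists_balanced_arc hG htri hT' hX
  obtain ⟨c, hc, hb, -⟩ := h.exists_isBalanced hG htri hT' infinite X h1 h2
  exact ⟨_, c, hc, hb⟩

end CombMap

/-! ### Building a spanning tree by a contour walk. -/

namespace CombMap

variable {D : Type*} {G : CombMap D}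

/-- The state of a contour walk from `x₀` after `i` steps. The edges outside `T` are those across
which a new face was entered, and `V` is the set of the faces seen so far. -/
structure WalkInv (G : CombMap D) (x₀ : D) (T : Set G.Edge) (V : Set G.Face) (i : ℕ) : Prop where
  root : G.face x₀ ∈ V
  crossed : ∀ x, G.edge x ∉ T → G.face x ∈ V
  -- In terms of invariant functions: all darts of seen faces lie in the orbit of `x₀`.
  merged : ∀ u : D → Prop, (∀ x, u (G.tour T x) = u x) → ∀ x, G.face x ∈ V → u x = u x₀
  past : ∀ t < i, G.face (G.rev ((G.tour T ^ t) x₀)) ∈ V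

namespace WalkInv

variable {x₀ : D} {T : Set G.Edge} {V : Set G.Face} {i : ℕ}

theorem init (x₀ : D) : G.WalkInv x₀ Set.univ {G.face x₀} 0 where
  root := rfl
  crossed x hx := absurd trivial hx
  merged u hu x hx := G.eq_of_face_eq (g := u) (fun y => by
    rw [← hu y, G.tour_of_mem (Set.mem_univ _), facePerm_apply]) hx
  past t ht := absurd ht (by omega)

theorem face_mem (h : G.WalkInv x₀ T V i) (t : ℕ) : G.face ((G.tour T ^ t) x₀) ∈ V := by
  induction t with
  | zero => exact h.root
  | succ t ih =>
    rw [pow_succ', Equiv.Perm.mul_apply]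
    by_cases hx : G.edge ((G.tour T ^ t) x₀) ∈ T
    · rwa [G.face_tour_of_mem hx]
    · rw [G.face_tour_of_notMem hx]
      exact h.crossed _ (by rwa [G.edge_rev])

theorem step (h : G.WalkInv x₀ T V i) (hi : G.face (G.rev ((G.tour T ^ i) x₀)) ∈ V) :
    G.WalkInv x₀ T V (i + 1) where
  root := h.root
  crossed := h.crossed
  merged := h.merged
  past t ht := by
    rcases Nat.lt_succ_iff_lt_or_eq.1 ht with h' | rfl
    · exact h.past t h'
    · exact hi

/-- Had the walk met either dart of this edge earlier, the face behind it would already be in `V`.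
So deleting the edge does not alter the past of the walk. -/
theorem pow_tour_remove (h : G.WalkInv x₀ T V i) (hi : G.face (G.rev ((G.tour T ^ i) x₀)) ∉ V) :
    ∀ t ≤ i, (G.tour (T \ {G.edge ((G.tour T ^ i) x₀)}) ^ t) x₀ = (G.tour T ^ t) x₀ := by
  intro t
  induction t with
  | zero => intro _; rfl
  | succ t ih =>
    intro ht
    rw [pow_succ', Equiv.Perm.mul_apply, ih (by omega), pow_succ', Equiv.Perm.mul_apply]
    set y := (G.tour T ^ t) x₀ with hy
    have hne : G.edge y ≠ G.edge ((G.tour T ^ i) x₀) := by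
      intro he
      rcases G.edge_eq_iff.1 he with h' | h'
      · exact hi (by rw [← h']; exact h.past t (by omega))
      · exact hi (by rw [← h']; exact h.face_mem t)
    by_cases hyT : G.edge y ∈ T
    · rw [G.tour_of_mem hyT,
        G.tour_of_mem (T := T \ {G.edge ((G.tour T ^ i) x₀)}) ⟨hyT, hne⟩]
    · rw [G.tour_of_notMem hyT, G.tour_of_notMem fun h' => hyT h'.1]

variable [Fintype D]

/-- The edges of an unseen face are all still in `T`, so its darts form an orbit of their own;
deleting the crossed edge splices this orbit into that of `x₀`. -/
theorem enter (h : G.WalkInv x₀ T V i) (htri : G.IsTriangulated)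
    (hi : G.face (G.rev ((G.tour T ^ i) x₀)) ∉ V) :
    G.WalkInv x₀ (T \ {G.edge ((G.tour T ^ i) x₀)})
      (insert (G.face (G.rev ((G.tour T ^ i) x₀))) V) (i + 1) := by
  have hpow := h.pow_tour_remove hi
  have hxV := h.face_mem i
  set x := (G.tour T ^ i) x₀ with hx
  set T' := T \ {G.edge x} with hT'
  have hxT : G.edge x ∈ T := by
    by_contra hxT
    exact hi (h.crossed _ (by rwa [G.edge_rev]))
  have hx' : G.edge x ∉ T' := fun h' => h'.2 rfl
  have htx : G.tour T' x = G.facePerm (G.rev x) := by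
    rw [G.tour_of_notMem hx', facePerm_apply, G.rev_rev]
  have htr : G.tour T' (G.rev x) = G.facePerm x := by
    rw [G.tour_of_notMem (by rwa [G.edge_rev]), facePerm_apply]
  refine ⟨Set.mem_insert_of_mem _ h.root, ?_, ?_, ?_⟩
  · intro y hy
    by_cases hyx : G.edge y = G.edge x
    · rcases G.edge_eq_iff.1 hyx with rfl | rfl
      · exact Set.mem_insert_of_mem _ hxV
      · exact Set.mem_insert _ _
    · exact Set.mem_insert_of_mem _ (h.crossed y fun h' => hy ⟨h', hyx⟩)
  · intro u hu
    have hface : ∀ y, G.face y = G.face (G.rev x) → y ≠ G.rev x → u (G.facePerm y) = u y := by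
      intro y hy hyr
      have hyT : G.edge y ∈ T' := by
        refine ⟨by_contra fun h' => hi (by rw [← hy]; exact h.crossed y h'), fun h' => ?_⟩
        rcases G.edge_eq_iff.1 h' with rfl | rfl
        · exact hi (by rw [← hy]; exact hxV)
        · exact hyr rfl
      rw [← hu y, G.tour_of_mem hyT, facePerm_apply]
    set a := G.facePerm (G.rev x) with ha
    set b := G.facePerm a with hb
    have hba : u b = u a := hface a (G.face_facePerm _) (htri.facePerm_ne _)
    have hrb : u (G.rev x) = u b := by
      rw [← hface b ((G.face_facePerm _).trans (G.face_facePerm _))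
        (htri.facePerm_facePerm_ne _), hb, ha, htri.facePerm_cube]
    have hax : u a = u x := by rw [← htx, hu]
    -- The old and new walks differ only at `x` and `G.rev x`, and there the relations around the
    -- triangle supply the old invariance.
    have hinv : ∀ y, u (G.tour T y) = u y := by
      intro y
      by_cases hyx : G.edge y = G.edge x
      · rcases G.edge_eq_iff.1 hyx with rfl | rfl
        · rw [G.tour_of_mem hxT, ← facePerm_apply, ← htr, hu, hrb, hba, hax]
        · rw [G.tour_of_mem (by rwa [G.edge_rev]), ← facePerm_apply, hrb, hba]
      · rw [← hu y]
        congr 1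
        by_cases hyT : G.edge y ∈ T
        · rw [G.tour_of_mem hyT, G.tour_of_mem (T := T') ⟨hyT, hyx⟩]
        · rw [G.tour_of_notMem hyT, G.tour_of_notMem fun h' => hyT h'.1]
    have hx0 := h.merged u hinv x hxV
    rintro y (hy | hy)
    · rcases htri.face_eq_iff.1 hy with rfl | rfl | rfl
      · rw [hrb, hba, hax, hx0]
      · rw [hax, hx0]
      · rw [hba, hax, hx0]
    · exact h.merged u hinv y hy
  · intro t ht
    rw [hpow t (by omega)]
    rcases Nat.lt_succ_iff_lt_or_eq.1 ht with h' | rfl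
    · exact Set.mem_insert_of_mem _ (h.past t h')
    · exact Set.mem_insert _ _

/-- After as many steps as there are darts, the walk has visited everything. -/
theorem sameCycle (h : G.WalkInv x₀ T V i) (hi : Fintype.card D ≤ i) (hG : G.Spans Set.univ) (x y : D) :
    (G.tour T).SameCycle x y := by
  classical
  have hcyc : ∀ x, G.face x ∈ V → (G.tour T).SameCycle x₀ x := fun x hx =>
    (h.merged (fun x => (G.tour T).SameCycle x₀ x)
      (fun x => by rw [Equiv.Perm.sameCycle_apply_right]) x hx).mpr (Equiv.Perm.SameCycle.refl _ _)
  -- By now the whole orbit of `x₀` has been traversed, so every face adjacent to a seen face is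
  -- seen; connectivity does the rest.
  have hrev : ∀ x, G.face x ∈ V → G.face (G.rev x) ∈ V := by
    intro x hx
    obtain ⟨t, rfl⟩ := (hcyc x hx).exists_nat_pow_eq
    have hp := Function.minimalPeriod_pos_of_mem_periodicPts
      (Function.Injective.mem_periodicPts (G.tour T).injective x₀)
    have hle : Function.minimalPeriod (G.tour T) x₀ ≤ Fintype.card D :=
      Function.minimalPeriod_le_card
    have hmod := Function.iterate_mod_minimalPeriod_eq (f := G.tour T) (x := x₀) (n := t)
    rw [← Equiv.Perm.iterate_eq_pow, ← hmod, Equiv.Perm.iterate_eq_pow]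
    exact h.past _ ((Nat.mod_lt _ hp).trans_le (hle.trans hi))
  have hrev' : ∀ x, (G.face (G.rev x) ∈ V) = (G.face x ∈ V) := fun x =>
    propext ⟨fun hx => by simpa [G.rev_rev] using hrev _ hx, hrev x⟩
  have hall : ∀ x, G.face x ∈ V := fun x =>
    (G.eq_of_spans hG (g := fun x => G.face x ∈ V)
      (fun x => by simp only [face_rot, hrev']) (fun x _ => hrev' x) x x₀).mpr h.root
  exact (hcyc x (hall x)).symm.trans (hcyc y (hall y))

end WalkInv

end CombMap

/-! ### Program logic for the random access machine. -/

namespace RamState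

variable (s : RamState)

@[simp]
theorem reg_setReg (x v y : ℕ) : (s.setReg x v).reg y = if y = x then v else s.reg y := by
  simp [setReg, Function.update_apply]

@[simp]
theorem arr_setReg (x v : ℕ) : (s.setReg x v).arr = s.arr := rfl

@[simp]
theorem reg_setArr (a i v : ℕ) : (s.setArr a i v).reg = s.reg := rfl

@[simp]
theorem arr_setArr (a i v b j : ℕ) :
    (s.setArr a i v).arr b j = if b = a ∧ j = i then v else s.arr b j := by
  by_cases h : b = a
  · subst h; simp [setArr, Function.update_apply]
  · simp [setArr, h]

end RamState

namespace RamProg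

/-- Run a list of programs one after the other. -/
def block : List RamProg → RamProg
  | [] => skip
  | p :: l => seq p (block l)

/-- A bound for the number of steps of a program without loops. -/
def cost : RamProg → ℕ
  | seq p q => p.cost + q.cost
  | ite _ p q => 1 + p.cost + q.cost
  | _ => 1

/-- The weakest precondition of a program without loops. -/
def wp (W : ℕ) : RamProg → (RamState → Prop) → RamState → Prop
  | skip, Q, s => Q s
  | const x c, Q, s => c ≤ W ∧ Q (s.setReg x c)
  | move x y, Q, s => Q (s.setReg x (s.reg y))
  | add x y z, Q, s => s.reg y + s.reg z ≤ W ∧ Q (s.setReg x (s.reg y + s.reg z))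
  | sub x y z, Q, s => Q (s.setReg x (s.reg y - s.reg z))
  | load x a y, Q, s => Q (s.setReg x (s.arr a (s.reg y)))
  | store a x y, Q, s => Q (s.setArr a (s.reg x) (s.reg y))
  | seq p q, Q, s => p.wp W (q.wp W Q) s
  | ite b p q, Q, s => (b.Holds s → p.wp W Q s) ∧ (¬ b.Holds s → q.wp W Q s)
  | loop _ _, _, _ => False

/-- The program halts within `k` steps in a state that satisfies `Q`. -/
def Runs (W : ℕ) (p : RamProg) (s : RamState) (k : ℕ) (Q : RamState → Prop) : Prop :=
  ∃ t s', RamExec W p s t s' ∧ t ≤ k ∧ Q s'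

variable {W : ℕ}

theorem Runs.of_wp {p : RamProg} {Q : RamState → Prop} {s : RamState} (h : p.wp W Q s) :
    Runs W p s p.cost Q := by
  induction p generalizing Q s with
  | skip => exact ⟨_, _, .skip s, le_rfl, h⟩
  | const x c => exact ⟨_, _, .const s x c h.1, le_rfl, h.2⟩
  | move x y => exact ⟨_, _, .move s x y, le_rfl, h⟩
  | add x y z => exact ⟨_, _, .add s x y z h.1, le_rfl, h.2⟩
  | sub x y z => exact ⟨_, _, .sub s x y z, le_rfl, h⟩
  | load x a y => exact ⟨_, _, .load s x a y, le_rfl, h⟩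
  | store a x y => exact ⟨_, _, .store s a x y, le_rfl, h⟩
  | seq p q ihp ihq =>
    obtain ⟨t, s', h1, ht, h2⟩ := ihp h
    obtain ⟨t', s'', h3, ht', h4⟩ := ihq h2
    exact ⟨_, _, .seq h1 h3, by simp only [cost]; omega, h4⟩
  | ite b p q ihp ihq =>
    by_cases hb : b.Holds s
    · obtain ⟨t, s', h1, ht, h2⟩ := ihp (h.1 hb)
      exact ⟨_, _, .ite_true hb h1, by simp only [cost]; omega, h2⟩
    · obtain ⟨t, s', h1, ht, h2⟩ := ihq (h.2 hb)
      exact ⟨_, _, .ite_false hb h1, by simp only [cost]; omega, h2⟩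
  | loop b p => exact h.elim

theorem Runs.seq {p q : RamProg} {Q R : RamState → Prop} {s : RamState} {k l : ℕ}
    (h : Runs W p s k Q) (h' : ∀ s', Q s' → Runs W q s' l R) :
    Runs W (.seq p q) s (k + l) R := by
  obtain ⟨t, s', h1, ht, h2⟩ := h
  obtain ⟨t', s'', h3, ht', h4⟩ := h' s' h2
  exact ⟨_, _, .seq h1 h3, by omega, h4⟩

theorem Runs.mono {p : RamProg} {Q R : RamState → Prop} {s : RamState} {k l : ℕ}
    (h : Runs W p s k Q) (hkl : k ≤ l) (hQR : ∀ s', Q s' → R s') : Runs W p s l R := by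
  obtain ⟨t, s', h1, ht, h2⟩ := h
  exact ⟨t, s', h1, ht.trans hkl, hQR _ h2⟩

/-- A loop with a loop-free body and an invariant indexed by the number of rounds done. -/
theorem Runs.loop {b : RamTest} {p : RamProg} (I : ℕ → RamState → Prop) (N : ℕ)
    (hstep : ∀ i < N, ∀ s, I i s → b.Holds s ∧ p.wp W (I (i + 1)) s)
    (hend : ∀ s, I N s → ¬ b.Holds s) {s : RamState} (h0 : I 0 s) :
    Runs W (.loop b p) s (N * (p.cost + 1) + 1) (I N) := by
  -- Induction on the rounds left. Each costs its body and one test; the failing last test costs 1.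
  have key : ∀ m ≤ N, ∀ s, I (N - m) s → Runs W (.loop b p) s (m * (p.cost + 1) + 1) (I N) := by
    intro m
    induction m with
    | zero =>
      intro _ s hs
      exact ⟨1, s, .loop_done (hend s hs), by omega, hs⟩
    | succ m ih =>
      intro hm s hs
      obtain ⟨hb, hw⟩ := hstep _ (by omega) s hs
      obtain ⟨t, s', h1, ht, h2⟩ := Runs.of_wp hw
      rw [show N - (m + 1) + 1 = N - m by omega] at h2
      obtain ⟨t', s'', h3, ht', h4⟩ := ih (by omega) s' h2
      exact ⟨_, _, .loop_step hb h1 h3, by rw [Nat.add_mul]; omega, h4⟩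
  exact key N le_rfl s (by rwa [Nat.sub_self])

end RamProg

/-! ### The programs. -/

namespace RamProg

/-- Replace the dart in register 4 by the next dart of the contour walk. -/
def stepTour : RamProg :=
  block [load 8 3 4, ite (.eq 8 2) (load 4 0 4) skip, load 4 1 4]

/-- Mark in array 7 the three darts on the face of the dart in register 9. -/
def markFace : RamProg :=
  block [store 7 9 2, load 9 0 9, load 9 1 9, store 7 9 2, load 9 0 9, load 9 1 9, store 7 9 2]

/-- One step of the walk that builds a spanning tree. -/
def buildBody : RamProg :=
  block [load 9 0 4, load 8 7 9,
    ite (.eq 8 2) skip (block [store 3 4 3, store 3 9 3, markFace]), stepTour, add 6 6 2]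

/-- Compute a spanning tree in array 3: start with all edges, and remove an edge whenever the
contour walk meets a new face behind it. -/
def buildTree : RamProg :=
  block [const 2 1, const 3 0, const 6 0,
    loop (.lt 6 0) (block [store 3 6 2, add 6 6 2]),
    block [const 4 0, const 9 0, markFace, const 6 0],
    loop (.lt 6 0) buildBody]

/-- One step of the contour walk: count the marked darts in array 5 and number the darts
in array 6. -/
def countBody : RamProg :=
  block [load 7 2 4, add 5 5 7, store 5 4 5, store 6 4 6, stepTour, add 6 6 2]

/-- Keep the dart in register 6 in register 1 if its arc is balanced. -/
def searchBody : RamProg :=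
  block [load 7 3 6,
    -- Register 9 ends up with four times the weight of the arc, register 10 with three times the
    -- total, which is in register 5. Subtraction is truncated, so an arc past the start of the walk
    -- weighs 0.
    ite (.eq 7 2) skip (block [load 8 0 6, load 9 5 8, load 10 5 6, sub 9 9 10, add 9 9 9,
      add 9 9 9, add 10 5 5, add 10 10 5,
      ite (.lt 9 5) skip (ite (.lt 10 9) skip (move 1 6))]),
    add 6 6 2]

/-- Compute in register `x` whether the number in register 13 is larger than that in register 11
and at most that in register 12. -/
def testArc (x : ℕ) : RamProg :=
  block [const x 0, ite (.lt 11 13) (ite (.lt 12 13) skip (const x 1)) skip]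

/-- Mark the dart in register 6 in array 4 if its edge leaves the arc. -/
def markBody : RamProg :=
  block [load 13 6 6, testArc 8, load 7 0 6, load 13 6 7, testArc 9,
    ite (.eq 8 9) (const 10 0) (const 10 1), store 4 6 10, add 6 6 2]

/-- Find a balanced fundamental cycle of the spanning tree in array 3. -/
def separate : RamProg :=
  block [block [const 2 1, const 4 0, const 5 0, const 6 0],
    loop (.lt 6 0) countBody, const 6 0,
    loop (.lt 6 0) searchBody,
    block [load 11 6 1, load 7 0 1, load 12 6 7, const 6 0],
    loop (.lt 6 0) markBody]

end RamProg

/-! ### Prefix sums along the contour walk. -/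

namespace CombMap

open RamProg

variable {n : ℕ} {G : CombMap (Fin n)} {X : Set G.Face} {T : Set G.Edge} {W : ℕ}

/-- The memory holds the graph, the terminals and the set `T` of edges, and register 2
holds 1. -/
structure Holds (G : CombMap (Fin n)) (X : Set G.Face) (T : Set G.Edge) (s : RamState) :
    Prop where
  size : s.reg 0 = n
  one : s.reg 2 = 1
  rev : ∀ d : Fin n, s.arr 0 d = G.rev d
  rot : ∀ d : Fin n, s.arr 1 d = G.rot d
  terminal : ∀ d : Fin n, s.arr 2 d = bit01 (G.face d ∈ X)
  tree : ∀ d : Fin n, s.arr 3 d = bit01 (G.edge d ∈ T)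

theorem bit01_eq_one_iff {p : Prop} : bit01 p = 1 ↔ p := by
  unfold bit01; split_ifs <;> simp [*]

theorem Holds.congr {s s' : RamState} (h : G.Holds X T s)
    (hreg : s'.reg 0 = s.reg 0 ∧ s'.reg 2 = s.reg 2) (harr : ∀ a < 4, s'.arr a = s.arr a) :
    G.Holds X T s' where
  size := hreg.1.trans h.size
  one := hreg.2.trans h.one
  rev d := by rw [harr 0 (by norm_num), h.rev]
  rot d := by rw [harr 1 (by norm_num), h.rot]
  terminal d := by rw [harr 2 (by norm_num), h.terminal]
  tree d := by rw [harr 3 (by norm_num), h.tree]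

theorem wp_stepTour {Q : RamState → Prop} {s : RamState} (h : G.Holds X T s) {x : Fin n}
    (hx : s.reg 4 = x)
    (hQ : ∀ s', s'.arr = s.arr → (∀ r, r ≠ 4 → r ≠ 8 → s'.reg r = s.reg r) →
      s'.reg 4 = (G.tour T x : ℕ) → Q s') :
    stepTour.wp W Q s := by
  simp only [stepTour, block, wp, RamTest.Holds, RamState.reg_setReg, RamState.arr_setReg, hx,
    h.tree, h.one]
  norm_num
  rw [bit01_eq_one_iff]
  refine ⟨fun hT => hQ _ rfl (fun r h4 h8 => ?_) ?_, fun hT => hQ _ rfl (fun r h4 h8 => ?_) ?_⟩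
  · simp [h4, h8]
  · simp [h.rev, h.rot, G.tour_of_mem hT]
  · simp [h4, h8]
  · simp [h.rot, G.tour_of_notMem hT]

/-- The weight of the first `i` darts of the contour walk. -/
noncomputable def prefixWeight (X : Set G.Face) (T : Set G.Edge) (x₀ : Fin n) (i : ℕ) : ℕ :=
  ∑ t ∈ Finset.range i, bit01 (G.face ((G.tour T ^ t) x₀) ∈ X)

theorem prefixWeight_le (x₀ : Fin n) (i : ℕ) : prefixWeight X T x₀ i ≤ i := by
  simpa [prefixWeight] using Finset.sum_le_card_nsmul (Finset.range i) _ 1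
    fun t _ => bit01_le (G.face ((G.tour T ^ t) x₀) ∈ X)

theorem prefixWeight_mono (x₀ : Fin n) : Monotone (prefixWeight X T x₀) := fun i j h => by
  exact Finset.sum_le_sum_of_subset (Finset.range_mono h)

/-- The arc omits its start at position `i`, hence the prefix up to and including that position. -/
theorem prefixWeight_add (x₀ : Fin n) (i L : ℕ) :
    prefixWeight X T x₀ (i + L + 1) = prefixWeight X T x₀ (i + 1) +
      arcWeight (G.tour T) (fun x => bit01 (G.face x ∈ X)) ((G.tour T ^ i) x₀) L := by
  rw [show i + L + 1 = i + 1 + L by omega, prefixWeight, Finset.sum_range_add, prefixWeight,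
    arcWeight]
  congr 1
  refine Finset.sum_congr rfl fun t _ => ?_
  rw [← Equiv.Perm.mul_apply, ← pow_add, show t + 1 + i = i + 1 + t by omega]

theorem prefixWeight_card (hT : ∀ x y, (G.tour T).SameCycle x y) (htri : G.IsTriangulated)
    (x₀ : Fin n) : prefixWeight X T x₀ n = 3 * X.ncard := by
  have h := prefixWeight_add (X := X) (T := T) x₀ 0 (n - 1)
  have h2 := arcWeight_succ (σ := G.tour T) (fun x => bit01 (G.face x ∈ X)) x₀ (n - 1)
  have h3 := arcWeight_card hT (fun x => bit01 (G.face x ∈ X)) x₀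
  have h4 := pow_card_of_sameCycle hT x₀
  have hn : 0 < n := x₀.pos
  rw [Fintype.card_fin] at h3 h4
  rw [show 0 + (n - 1) + 1 = n by omega] at h
  rw [show n - 1 + 1 = n by omega, h3, h4, htri.sum_bit01] at h2
  have h5 : prefixWeight X T x₀ 1 = bit01 (G.face x₀ ∈ X) := by simp [prefixWeight]
  simp only [zero_add, pow_zero, Equiv.Perm.one_apply] at h
  omega

/-- The state after `i` rounds of `countBody`. -/
structure CountInv (G : CombMap (Fin n)) (X : Set G.Face) (T : Set G.Edge) (x₀ : Fin n) (i : ℕ)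
    (s : RamState) : Prop extends G.Holds X T s where
  dart : s.reg 4 = ((G.tour T ^ i) x₀ : Fin n)
  total : s.reg 5 = prefixWeight X T x₀ i
  counter : s.reg 6 = i
  count : ∀ t < i, s.arr 5 ((G.tour T ^ t) x₀ : Fin n) = prefixWeight X T x₀ (t + 1)
  number : ∀ t < i, s.arr 6 ((G.tour T ^ t) x₀ : Fin n) = t

theorem CountInv.step (hT : ∀ x y, (G.tour T).SameCycle x y) (hW : n ≤ W) {x₀ : Fin n} {i : ℕ}
    (hi : i < n) {s : RamState} (h : CountInv G X T x₀ i s) :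
    countBody.wp W (CountInv G X T x₀ (i + 1)) s := by
  have h4 := h.dart
  have h5 := h.total
  have h6 := h.counter
  have hX := h.terminal
  have hP : prefixWeight X T x₀ i + bit01 (G.face ((G.tour T ^ i) x₀) ∈ X)
      = prefixWeight X T x₀ (i + 1) := (Finset.sum_range_succ _ _).symm
  have hle := prefixWeight_le (X := X) (T := T) x₀ (i + 1)
  -- The walk has not returned to an earlier dart, so the new entries overwrite none of the old
  -- ones.
  have hinj : ∀ t < i, (((G.tour T ^ t) x₀ : Fin n) : ℕ) ≠ ((G.tour T ^ i) x₀ : Fin n) := by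
    intro t ht h
    have := pow_inj_of_sameCycle hT (by rw [Fintype.card_fin]; omega)
      (by rwa [Fintype.card_fin]) (Fin.ext h)
    omega
  have hcnt : ∀ t < i + 1, (if (((G.tour T ^ t) x₀ : Fin n) : ℕ) = ((G.tour T ^ i) x₀ : Fin n)
      then prefixWeight X T x₀ (i + 1) else s.arr 5 ((G.tour T ^ t) x₀ : Fin n))
      = prefixWeight X T x₀ (t + 1) := by
    intro t ht
    rcases Nat.lt_succ_iff_lt_or_eq.1 ht with h' | rfl
    · rw [if_neg (hinj t h'), h.count t h']
    · rw [if_pos rfl]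
  have hnm : ∀ t < i + 1, (if (((G.tour T ^ t) x₀ : Fin n) : ℕ) = ((G.tour T ^ i) x₀ : Fin n)
      then i else s.arr 6 ((G.tour T ^ t) x₀ : Fin n)) = t := by
    intro t ht
    rcases Nat.lt_succ_iff_lt_or_eq.1 ht with h' | rfl
    · rw [if_neg (hinj t h'), h.number t h']
    · rw [if_pos rfl]
  simp only [countBody, block, wp, RamState.reg_setReg, RamState.reg_setArr]
  norm_num
  simp only [h4, h5, h6, hX, hP]
  refine ⟨by omega, wp_stepTour (X := X) (T := T) (x := (G.tour T ^ i) x₀)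
    (h.toHolds.congr ?_ ?_) ?_ fun s' harr hreg h4' => ?_⟩
  · simp 
  · intro a ha
    ext j
    simp [show a ≠ 5 by omega, show a ≠ 6 by omega]
  · simp [h4]
  have h6' : s'.reg 6 = i := by
    simp [hreg, h6]
  have h2' : s'.reg 2 = 1 := by
    simp [hreg, h.one]
  refine ⟨by omega, h.toHolds.congr ?_ ?_, ?_, ?_, ?_, fun t ht => ?_, fun t ht => ?_⟩
  · simp [hreg]
  · intro a ha
    ext j
    simp [harr, show a ≠ 5 by omega,
      show a ≠ 6 by omega]
  · simp [h4', pow_succ']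
  · simp [hreg]
  · simp [h6', h2']
  · simpa [harr] using hcnt t ht
  · simpa [harr] using hnm t ht

end CombMap

/-! ### Correctness of the search and of the marking. -/

namespace CombMap

open RamProg

variable {n : ℕ} {G : CombMap (Fin n)} {X : Set G.Face} {T : Set G.Edge} {W : ℕ}
  {x₀ : Fin n} {p : Fin n → ℕ}

/-- `p` numbers the darts along the contour walk from `x₀`. -/
def IsNumbering (G : CombMap (Fin n)) (T : Set G.Edge) (x₀ : Fin n) (p : Fin n → ℕ) : Prop :=
  ∀ d, p d < n ∧ (G.tour T ^ p d) x₀ = d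

/-- The arc of `d` does not pass through the start of the contour walk, and it is balanced. -/
structure IsCut (G : CombMap (Fin n)) (X : Set G.Face) (T : Set G.Edge) (x₀ : Fin n)
    (p : Fin n → ℕ) (d : Fin n) : Prop where
  notMem : G.edge d ∉ T
  lower : 3 * X.ncard ≤
    4 * (prefixWeight X T x₀ (p (G.rev d) + 1) - prefixWeight X T x₀ (p d + 1))
  upper : 4 * (prefixWeight X T x₀ (p (G.rev d) + 1) - prefixWeight X T x₀ (p d + 1)) ≤
    3 * (3 * X.ncard)

theorem IsNumbering.prefixWeight_sub (hp : G.IsNumbering T x₀ p) {d e : Fin n}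
    (hde : p d ≤ p e) :
    prefixWeight X T x₀ (p e + 1) - prefixWeight X T x₀ (p d + 1) =
      arcWeight (G.tour T) (fun x => bit01 (G.face x ∈ X)) d (p e - p d) := by
  have := prefixWeight_add (X := X) (T := T) x₀ (p d) (p e - p d)
  rw [Nat.add_sub_cancel' hde, (hp d).2] at this
  omega

theorem IsNumbering.pow_sub (hp : G.IsNumbering T x₀ p) {d e : Fin n} (hde : p d ≤ p e) :
    (G.tour T ^ (p e - p d)) d = e := by
  conv_lhs => rw [← (hp d).2]
  rw [← Equiv.Perm.mul_apply, (hp d).2, ← pow_add, Nat.sub_add_cancel hde, (hp e).2]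

theorem IsNumbering.inArc_iff (hp : G.IsNumbering T x₀ p)
    (hT : ∀ x y, (G.tour T).SameCycle x y) {d : Fin n} {L : ℕ} (hL : p d + L < n) (x : Fin n) :
    InArc (G.tour T) d L x ↔ p d < p x ∧ p x ≤ p d + L := by
  constructor
  · rintro ⟨t, ht, h⟩
    rw [← (hp d).2, ← Equiv.Perm.mul_apply, ← pow_add] at h
    have := pow_inj_of_sameCycle hT (by rw [Fintype.card_fin]; omega)
      (by rw [Fintype.card_fin]; exact (hp x).1) (h.trans (hp x).2.symm)
    omega
  · rintro ⟨h1, h2⟩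
    refine ⟨p x - p d - 1, by omega, ?_⟩
    rw [show p x - p d - 1 + 1 = p x - p d by omega, hp.pow_sub h1.le]

/-- Prefix weights are monotone, so in the wrong order the truncated difference is 0, below the
positive lower bound. -/
theorem IsCut.lt {d : Fin n} (h : G.IsCut X T x₀ p d) (hX : 4 ≤ X.ncard) :
    p d < p (G.rev d) := by
  by_contra hle
  have := prefixWeight_mono (X := X) (T := T) x₀
    (show p (G.rev d) + 1 ≤ p d + 1 by omega)
  have := h.lower
  omega

theorem IsCut.isArc {d : Fin n} (h : G.IsCut X T x₀ p d) (hX : 4 ≤ X.ncard)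
    (hp : G.IsNumbering T x₀ p) : G.IsArc T d (p (G.rev d) - p d) := by
  have hlt := h.lt hX
  have := (hp (G.rev d)).1
  exact ⟨h.notMem, by rw [Fintype.card_fin]; omega, hp.pow_sub hlt.le⟩

/-- The condition `3 * k ≤ 4 * w ≤ 9 * k` is symmetric under `w ↦ 3 * k - w`. So of a balanced arc
and its reverse, the one that avoids the start of the walk may be taken. -/
theorem exists_isCut (hG : G.IsPlane) (htri : G.IsTriangulated)
    (hT : ∀ x y, (G.tour T).SameCycle x y) (hX : 4 ≤ X.ncard) (hp : G.IsNumbering T x₀ p) :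
    ∃ d, G.IsCut X T x₀ p d := by
  have key : ∀ d L, G.IsArc T d L →
      3 * X.ncard ≤ 4 * arcWeight (G.tour T) (fun x => bit01 (G.face x ∈ X)) d L →
      4 * arcWeight (G.tour T) (fun x => bit01 (G.face x ∈ X)) d L ≤ 3 * (3 * X.ncard) →
      p d < p (G.rev d) → G.IsCut X T x₀ p d := by
    intro d L h h1 h2 hlt
    have hn := (hp (G.rev d)).1
    have hL : p (G.rev d) - p d = L :=
      pow_inj_of_sameCycle hT (by rw [Fintype.card_fin]; omega) h.lt_card
        ((hp.pow_sub hlt.le).trans h.pow_eq.symm)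
    have hw := hp.prefixWeight_sub (X := X) hlt.le
    rw [hL] at hw
    exact ⟨h.notMem, by rwa [hw], by rwa [hw]⟩
  obtain ⟨d, L, h, h1, h2⟩ := exists_balanced_arc hG htri hT hX
  rcases lt_trichotomy (p d) (p (G.rev d)) with hlt | heq | hlt
  · exact ⟨d, key d L h h1 h2 hlt⟩
  · have := (hp (G.rev d)).2
    rw [← heq, (hp d).2] at this
    exact absurd this.symm (G.rev_ne d)
  · have hsum := arcWeight_add (σ := G.tour T) (fun x => bit01 (G.face x ∈ X)) d L
      (Fintype.card (Fin n) - L)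
    rw [Nat.add_sub_cancel' h.lt_card.le, arcWeight_card hT, htri.sum_bit01, h.pow_eq] at hsum
    exact ⟨G.rev d, key _ _ (h.reverse hT) (by omega) (by omega) (by rwa [G.rev_rev])⟩

/-- The memory after the contour walk: array 6 holds the numbering and array 5 the weights. -/
structure Tables (G : CombMap (Fin n)) (X : Set G.Face) (T : Set G.Edge) (x₀ : Fin n)
    (p : Fin n → ℕ) (s : RamState) : Prop extends G.Holds X T s where
  total : s.reg 5 = 3 * X.ncard
  count : ∀ d : Fin n, s.arr 5 d = prefixWeight X T x₀ (p d + 1)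
  number : ∀ d : Fin n, s.arr 6 d = p d

theorem CountInv.tables (htri : G.IsTriangulated) (hT : ∀ x y, (G.tour T).SameCycle x y)
    (hp : G.IsNumbering T x₀ p) {s : RamState} (h : CountInv G X T x₀ n s) :
    G.Tables X T x₀ p s where
  toHolds := h.toHolds
  total := by rw [h.total, prefixWeight_card hT htri]
  count d := by
    have := h.count (p d) (hp d).1
    rwa [(hp d).2] at this
  number d := by
    have := h.number (p d) (hp d).1
    rwa [(hp d).2] at this

theorem Tables.congr {s s' : RamState} (h : G.Tables X T x₀ p s)
    (hreg : s'.reg 0 = s.reg 0 ∧ s'.reg 2 = s.reg 2 ∧ s'.reg 5 = s.reg 5)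
    (harr : ∀ a, a ≠ 4 → s'.arr a = s.arr a) : G.Tables X T x₀ p s' where
  toHolds := h.toHolds.congr ⟨hreg.1, hreg.2.1⟩ fun a ha => harr a (by omega)
  total := hreg.2.2.trans h.total
  count d := by rw [harr 5 (by norm_num), h.count]
  number d := by rw [harr 6 (by norm_num), h.number]

/-- The state after `i` rounds of `searchBody`. -/
structure SearchInv (G : CombMap (Fin n)) (X : Set G.Face) (T : Set G.Edge) (x₀ : Fin n)
    (p : Fin n → ℕ) (i : ℕ) (s : RamState) : Prop extends G.Tables X T x₀ p s where
  counter : s.reg 6 = i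
  found : (∃ d : Fin n, (d : ℕ) < i ∧ G.IsCut X T x₀ p d) →
    ∃ d : Fin n, s.reg 1 = d ∧ G.IsCut X T x₀ p d

theorem SearchInv.next {i : ℕ} (hi : i < n) {s s' : RamState}
    (h : SearchInv G X T x₀ p i s)
    (hreg : s'.reg 0 = s.reg 0 ∧ s'.reg 2 = s.reg 2 ∧ s'.reg 5 = s.reg 5 ∧ s'.reg 6 = i + 1)
    (harr : s'.arr = s.arr)
    (h1 : (G.IsCut X T x₀ p ⟨i, hi⟩ ∧ s'.reg 1 = i) ∨
      (¬ G.IsCut X T x₀ p ⟨i, hi⟩ ∧ s'.reg 1 = s.reg 1)) :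
    SearchInv G X T x₀ p (i + 1) s' := by
  refine ⟨h.toTables.congr ⟨hreg.1, hreg.2.1, hreg.2.2.1⟩ fun a _ => by rw [harr],
    hreg.2.2.2, ?_⟩
  · rintro ⟨d, hd, hcut⟩
    rcases h1 with ⟨hc, h1⟩ | ⟨hc, h1⟩
    · exact ⟨⟨i, hi⟩, h1, hc⟩
    · obtain ⟨d', hd', hc'⟩ := h.found ⟨d, by
        rcases Nat.lt_succ_iff_lt_or_eq.1 hd with h' | h'
        · exact h'
        · exact absurd hcut (by rwa [show d = ⟨i, hi⟩ from Fin.ext h']), hcut⟩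
      exact ⟨d', h1.trans hd', hc'⟩

theorem SearchInv.step (htri : G.IsTriangulated) (hT : ∀ x y, (G.tour T).SameCycle x y)
    (hp : G.IsNumbering T x₀ p) (hW : 4 * n ≤ W) {i : ℕ} (hi : i < n) {s : RamState}
    (h : SearchInv G X T x₀ p i s) : searchBody.wp W (SearchInv G X T x₀ p (i + 1)) s := by
  have h5 := h.total
  have h6 : s.reg 6 = (⟨i, hi⟩ : Fin n) := h.counter
  set d : Fin n := ⟨i, hi⟩ with hd
  -- Prefix weights are at most `3 * k ≤ n`, so the fourfold weights fit into words up to `4 * n`.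
  have hle : 3 * X.ncard ≤ n := by
    rw [← prefixWeight_card hT htri x₀]; exact prefixWeight_le _ _
  have hw := prefixWeight_mono (X := X) (T := T) x₀ (Nat.succ_le_of_lt (hp (G.rev d)).1)
  rw [prefixWeight_card hT htri] at hw
  change prefixWeight X T x₀ (p (G.rev d) + 1) ≤ _ at hw
  simp only [searchBody, block, wp, RamTest.Holds, RamState.reg_setReg, RamState.arr_setReg, h6]
  norm_num
  simp only [h.tree, h.rev, h.count, h5, h.one, bit01_eq_one_iff]
  refine ⟨fun hdT => ?_, fun hdT => ⟨by omega, by omega, by omega, by omega,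
    fun hlt => ?_, fun hlt => ⟨fun hlt' => ?_, fun hlt' => ?_⟩⟩⟩
  · exact ⟨by omega, h.next hi (by simp [hd]) (by simp)
      (Or.inr ⟨fun hc => hc.notMem hdT, by simp⟩)⟩
  · exact ⟨by omega, h.next hi (by simp [h5, hd]) (by simp)
      (Or.inr ⟨fun hc => by have := hc.lower; rw [← hd] at this; omega, by simp⟩)⟩
  · exact ⟨by omega, h.next hi (by simp [h5, hd]) (by simp)
      (Or.inr ⟨fun hc => by have := hc.upper; rw [← hd] at this; omega, by simp⟩)⟩
  · exact ⟨by omega, h.next hi (by simp [h5, hd]) (by simp)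
      (Or.inl ⟨⟨hdT, by rw [← hd]; omega, by rw [← hd]; omega⟩, by simp [hd]⟩)⟩

/-- The dart `x` lies on the arc from `e` to `G.rev e`, by the numbering. -/
def Between (G : CombMap (Fin n)) (p : Fin n → ℕ) (e x : Fin n) : Prop :=
  p e < p x ∧ p x ≤ p (G.rev e)

/-- The state after `i` rounds of `markBody`. -/
structure MarkInv (G : CombMap (Fin n)) (X : Set G.Face) (T : Set G.Edge) (x₀ : Fin n)
    (p : Fin n → ℕ) (e : Fin n) (i : ℕ) (s : RamState) : Prop extends G.Tables X T x₀ p s where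
  chosen : s.reg 1 = e
  first : s.reg 11 = p e
  last : s.reg 12 = p (G.rev e)
  counter : s.reg 6 = i
  marked : ∀ d : Fin n, (d : ℕ) < i →
    s.arr 4 d = bit01 (¬ (G.Between p e d ↔ G.Between p e (G.rev d)))

theorem wp_testArc {Q : RamState → Prop} {s : RamState} {e x : Fin n} {r : ℕ} (hr : r < 11)
    (hW : 1 ≤ W) (h11 : s.reg 11 = p e) (h12 : s.reg 12 = p (G.rev e)) (h13 : s.reg 13 = p x)
    (hQ : ∀ s', s'.arr = s.arr → (∀ y, y ≠ r → s'.reg y = s.reg y) →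
      s'.reg r = bit01 (G.Between p e x) → Q s') :
    (testArc r).wp W Q s := by
  simp only [testArc, block, wp, RamTest.Holds, RamState.reg_setReg, if_neg (by omega : 11 ≠ r),
    if_neg (by omega : 12 ≠ r), if_neg (by omega : 13 ≠ r), h11, h12, h13]
  refine ⟨by omega, fun h1 => ⟨fun h2 => ?_, fun h2 => ⟨hW, ?_⟩⟩, fun h1 => ?_⟩
  · refine hQ _ rfl (fun y hy => by simp [hy]) ?_
    rw [bit01_of_not fun h : G.Between p e x => by have := h.2; omega]; simp
  · refine hQ _ rfl (fun y hy => by simp [hy]) ?_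
    rw [bit01_of ⟨h1, by omega⟩]; simp
  · refine hQ _ rfl (fun y hy => by simp [hy]) ?_
    rw [bit01_of_not fun h : G.Between p e x => h1 h.1]; simp

theorem MarkInv.step (hW : n ≤ W) {e : Fin n} {i : ℕ} (hi : i < n) {s : RamState}
    (h : MarkInv G X T x₀ p e i s) : markBody.wp W (MarkInv G X T x₀ p e (i + 1)) s := by
  have h6 : s.reg 6 = (⟨i, hi⟩ : Fin n) := h.counter
  set d : Fin n := ⟨i, hi⟩ with hd
  have hfin : ∀ s' : RamState, s'.arr = s.arr →
      (∀ r, r = 0 ∨ r = 1 ∨ r = 2 ∨ r = 5 ∨ r = 6 ∨ r = 11 ∨ r = 12 → s'.reg r = s.reg r) →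
      s'.reg 10 = bit01 (¬ (G.Between p e d ↔ G.Between p e (G.rev d))) →
      (block [store 4 6 10, add 6 6 2]).wp W (MarkInv G X T x₀ p e (i + 1)) s' := by
    intro s' harr hreg h10
    simp only [block, wp, RamState.reg_setArr, hreg 6 (by norm_num), hreg 2 (by norm_num), h10,
      h6, h.one]
    refine ⟨by have := d.isLt; omega, h.toTables.congr ?_ fun a ha => ?_, ?_, ?_, ?_, ?_,
      fun d' hd' => ?_⟩
    · simp [hreg]
    · ext j; simp [ha, harr]
    · simp [hreg, h.chosen]
    · simp [hreg, h.first]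
    · simp [hreg, h.last]
    · simp [hd]
    · by_cases hdd : d' = d
      · simp [hdd]
      · have hne : (d' : ℕ) ≠ d := fun h' => hdd (Fin.ext h')
        have hne' : (d' : ℕ) ≠ i := hne
        simpa [hne, harr] using h.marked d' (by omega)
  rw [markBody]
  simp only [block, wp, h6]
  refine wp_testArc (p := p) (e := e) (x := d) (G := G) (by norm_num) (by omega) (by simp [h.first])
    (by simp [h.last]) (by simp [h.number]) fun s₁ harr₁ hreg₁ hb₁ => ?_
  have e6 : s₁.reg 6 = d := by rw [hreg₁ 6 (by norm_num)]; simpa using h6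
  have er : s₁.arr 0 d = G.rev d := by rw [harr₁]; simpa using h.rev d
  have ep : s₁.arr 6 (G.rev d) = p (G.rev d) := by rw [harr₁]; simpa using h.number (G.rev d)
  refine wp_testArc (p := p) (e := e) (x := G.rev d) (G := G) (by norm_num) (by omega)
    (by simp [hreg₁, h.first]) (by simp [hreg₁, h.last]) (by simp [e6, er, ep])
    fun s₂ harr₂ hreg₂ hb₂ => ?_
  have hb₁' : s₂.reg 8 = bit01 (G.Between p e d) := by
    rw [hreg₂ 8 (by norm_num)]; simpa using hb₁
  have hregs : ∀ r, r = 0 ∨ r = 1 ∨ r = 2 ∨ r = 5 ∨ r = 6 ∨ r = 11 ∨ r = 12 →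
      s₂.reg r = s.reg r := by
    rintro r (rfl | rfl | rfl | rfl | rfl | rfl | rfl) <;> simp [hreg₂, hreg₁]
  have harrs : s₂.arr = s.arr := by rw [harr₂]; simp [harr₁]
  have hiff : s₂.reg 8 = s₂.reg 9 ↔ (G.Between p e d ↔ G.Between p e (G.rev d)) := by
    rw [hb₁', hb₂]
    by_cases h1 : G.Between p e d <;> by_cases h2 : G.Between p e (G.rev d) <;>
      simp [bit01, h1, h2]
  refine ⟨fun heq => ⟨by omega, hfin _ harrs (fun r hr => ?_) ?_⟩,
    fun hne => ⟨by omega, hfin _ harrs (fun r hr => ?_) ?_⟩⟩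
  · rw [RamState.reg_setReg, if_neg (by omega), hregs r hr]
  · rw [bit01_of_not fun h' => h' (hiff.1 heq)]; simp
  · rw [RamState.reg_setReg, if_neg (by omega), hregs r hr]
  · rw [bit01_of fun h' => hne (hiff.2 h')]; simp

/-- Nothing is assumed about the rest of the memory, so the program can also be run on what
`buildTree` leaves behind. -/
theorem runs_separate (hG : G.IsPlane) (htri : G.IsTriangulated) (hX : 4 ≤ X.ncard)
    (hT : ∀ x y, (G.tour T).SameCycle x y) (hW : 4 * n ≤ W) (infinite : G.Face) (x₀ : Fin n)
    (hx₀ : (x₀ : ℕ) = 0) {s : RamState} (h0 : s.reg 0 = n)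
    (hrev : ∀ d : Fin n, s.arr 0 d = G.rev d) (hrot : ∀ d : Fin n, s.arr 1 d = G.rot d)
    (hX2 : ∀ d : Fin n, s.arr 2 d = bit01 (G.face d ∈ X))
    (hT3 : ∀ d : Fin n, s.arr 3 d = bit01 (G.edge d ∈ T)) :
    Runs W separate s (200 * n) fun s' => ∃ (e : G.Edge) (c : G.SimpleCycle),
      G.IsFundamentalCycle T e c ∧ G.IsBalanced infinite X c ∧ G.IsOutput s' T e c := by
  have hn : 0 < n := x₀.pos
  obtain ⟨p, hp⟩ : ∃ p, G.IsNumbering T x₀ p := by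
    choose p hp using fun d => exists_pow_of_sameCycle hT x₀ d
    exact ⟨p, fun d => by simpa using hp d⟩
  have init : Runs W (block [const 2 1, const 4 0, const 5 0, const 6 0]) s _
      (CountInv G X T x₀ 0) := Runs.of_wp (by
    simp only [block, wp]
    refine ⟨by omega, by omega, by omega, by omega, ⟨?_, ?_, ?_, ?_, ?_, ?_⟩, ?_, ?_, ?_, ?_, ?_⟩
      <;> simp [h0, hrev, hrot, hX2, hT3, hx₀, prefixWeight])
  have main := init.seq fun s₁ (h₁ : CountInv G X T x₀ 0 s₁) =>
    (Runs.loop (b := .lt 6 0) (CountInv G X T x₀) n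
      (fun i hi s hs => ⟨by simp only [RamTest.Holds, hs.counter, hs.size]; exact hi,
        hs.step hT (by omega) hi⟩)
      (fun s hs => by simp [RamTest.Holds, hs.counter, hs.size]) h₁).seq
    fun s₂ h₂ => (Runs.of_wp (p := const 6 0) (Q := SearchInv G X T x₀ p 0) (by
      refine ⟨by omega, (h₂.tables htri hT hp).congr (by simp) (by simp), by simp, ?_⟩
      rintro ⟨d, hd, -⟩
      omega)).seq
    fun s₃ h₃ => (Runs.loop (b := .lt 6 0) (SearchInv G X T x₀ p) n
      (fun i hi s hs => ⟨by simp only [RamTest.Holds, hs.counter, hs.size]; exact hi,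
        hs.step htri hT hp hW hi⟩)
      (fun s hs => by simp [RamTest.Holds, hs.counter, hs.size]) h₃).seq
    fun s₄ h₄ => (Runs.of_wp (p := block [load 11 6 1, load 7 0 1, load 12 6 7, const 6 0])
      (Q := fun s => ∃ e, G.IsCut X T x₀ p e ∧ MarkInv G X T x₀ p e 0 s) (by
      obtain ⟨d, hd⟩ := exists_isCut hG htri hT hX hp
      obtain ⟨e, he, hcut⟩ := h₄.found ⟨d, d.isLt, hd⟩
      simp only [block, wp]
      refine ⟨by omega, e, hcut, h₄.toTables.congr (by simp) (by simp), ?_, ?_, ?_, ?_, ?_⟩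
      · simp [he]
      · simp [he, h₄.number]
      · simp [he, h₄.rev, h₄.number]
      · simp
      · intro d hd; omega)).seq
    fun s₅ h₅ => (show Runs W (.loop (.lt 6 0) markBody) s₅ (n * (markBody.cost + 1) + 1)
        (fun s => ∃ e, G.IsCut X T x₀ p e ∧ MarkInv G X T x₀ p e n s) by
      obtain ⟨e, hcut, hm⟩ := h₅
      exact (Runs.loop (b := .lt 6 0) (MarkInv G X T x₀ p e) n
        (fun i hi s hs => ⟨by simp only [RamTest.Holds, hs.counter, hs.size]; exact hi,
          hs.step (by omega) hi⟩)
        (fun s hs => by simp [RamTest.Holds, hs.counter, hs.size]) hm).mono le_rfl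
        fun s hs => ⟨e, hcut, hs⟩).seq
    fun s₆ h₆ => Runs.of_wp (p := .skip)
      (Q := fun s => ∃ e, G.IsCut X T x₀ p e ∧ MarkInv G X T x₀ p e n s) h₆
  refine main.mono ?_ fun s' hs' => ?_
  · simp only [cost, block, countBody, searchBody, markBody, testArc, stepTour]
    omega
  · obtain ⟨e, hcut, hm⟩ := hs'
    have hlt := hcut.lt hX
    have harc := hcut.isArc hX hp
    have hw := hp.prefixWeight_sub (X := X) hlt.le
    obtain ⟨c, hc, hbal, hedge⟩ := harc.exists_isBalanced hG htri hT infinite X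
      (by rw [← hw]; exact hcut.lower) (by rw [← hw]; exact hcut.upper)
    refine ⟨G.edge e, c, hc, hbal, hm.tree, ⟨e, hm.chosen, rfl⟩, fun d => ?_⟩
    have hn' := (hp (G.rev e)).1
    -- Along the numbering the arc is an interval of positions, so comparing positions decides
    -- membership.
    have hA : ∀ x, InArc (G.tour T) e (p (G.rev e) - p e) x ↔ G.Between p e x := fun x => by
      rw [hp.inArc_iff hT (by omega), Between, Nat.add_sub_cancel' hlt.le]
    rw [hm.marked d d.isLt, hedge, hA, hA]

end CombMap

/-! ### Correctness of the tree construction. -/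

namespace CombMap

open RamProg

variable {n : ℕ} {G : CombMap (Fin n)} {X : Set G.Face} {T : Set G.Edge} {W : ℕ} {x₀ : Fin n}

theorem wp_markFace {Q : RamState → Prop} {s : RamState} (htri : G.IsTriangulated) {r : Fin n}
    {V : Set G.Face} (h2 : s.reg 2 = 1) (h9 : s.reg 9 = r)
    (hrev : ∀ d : Fin n, s.arr 0 d = G.rev d) (hrot : ∀ d : Fin n, s.arr 1 d = G.rot d)
    (hV : ∀ d : Fin n, s.arr 7 d = bit01 (G.face d ∈ V))
    (hQ : ∀ s', (∀ a, a ≠ 7 → s'.arr a = s.arr a) → (∀ y, y ≠ 9 → s'.reg y = s.reg y) →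
      (∀ d : Fin n, s'.arr 7 d = bit01 (G.face d ∈ insert (G.face r) V)) → Q s') :
    markFace.wp W Q s := by
  simp only [markFace, block, wp]
  refine hQ _ (fun a ha => ?_) (fun y hy => ?_) fun d => ?_
  · ext j; simp [ha]
  · simp [hy]
  · have hf : G.face d ∈ insert (G.face r) V ↔
        d = r ∨ d = G.facePerm r ∨ d = G.facePerm (G.facePerm r) ∨ G.face d ∈ V := by
      rw [Set.mem_insert_iff, htri.face_eq_iff, or_assoc, or_assoc]
    simp only [facePerm_apply] at hf
    simp [h2, h9, hrev, hrot, hV, Fin.val_inj]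
    split_ifs with h1 h2 h3
    · exact (bit01_of (hf.2 (by tauto))).symm
    · exact (bit01_of (hf.2 (by tauto))).symm
    · exact (bit01_of (hf.2 (by tauto))).symm
    · rw [Set.mem_insert_iff] at hf
      rw [hf]
      simp [h1, h2, h3]

/-- The state after `i` rounds of `buildBody`. -/
structure BuildInv (G : CombMap (Fin n)) (X : Set G.Face) (x₀ : Fin n) (T : Set G.Edge)
    (V : Set G.Face) (i : ℕ) (s : RamState) : Prop extends G.Holds X T s, G.WalkInv x₀ T V i where
  zero : s.reg 3 = 0
  dart : s.reg 4 = ((G.tour T ^ i) x₀ : Fin n)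
  counter : s.reg 6 = i
  seen : ∀ d : Fin n, s.arr 7 d = bit01 (G.face d ∈ V)

/-- The common end of both branches of `buildBody`, whether or not a new face was entered. -/
theorem BuildInv.next {V : Set G.Face} {i : ℕ} (hW : n ≤ W) (hi : i < n) {s : RamState}
    (h : G.Holds X T s) (hwalk : G.WalkInv x₀ T V (i + 1)) (h3 : s.reg 3 = 0)
    (h4 : s.reg 4 = ((G.tour T ^ i) x₀ : Fin n)) (h6 : s.reg 6 = i)
    (hV : ∀ d : Fin n, s.arr 7 d = bit01 (G.face d ∈ V)) :
    (block [stepTour, add 6 6 2]).wp W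
      (fun s => ∃ T V, BuildInv G X x₀ T V (i + 1) s) s := by
  simp only [block, wp]
  refine wp_stepTour h h4 fun s' harr hreg h4' => ?_
  have h6' : s'.reg 6 = i := by simp [hreg, h6]
  have h2' : s'.reg 2 = 1 := by simp [hreg, h.one]
  refine ⟨by omega, T, V, h.congr ?_ fun a _ => ?_, hwalk, ?_, ?_, ?_, ?_⟩
  · simp [hreg]
  · simp [harr]
  · simp [hreg, h3]
  · simp [h4', pow_succ']
  · simp [h6', h2']
  · simpa [harr] using hV

theorem BuildInv.step (htri : G.IsTriangulated) {V : Set G.Face} {i : ℕ} (hW : n ≤ W)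
    (hi : i < n) {s : RamState} (h : BuildInv G X x₀ T V i s) :
    buildBody.wp W (fun s => ∃ T V, BuildInv G X x₀ T V (i + 1) s) s := by
  have h4 := h.dart
  have hwalk := h.toWalkInv
  set x := (G.tour T ^ i) x₀ with hx
  change wp W (seq (load 9 0 4) (seq (load 8 7 9) (seq (.ite (.eq 8 2) .skip
    (block [store 3 4 3, store 3 9 3, markFace])) (block [stepTour, add 6 6 2])))) _ s
  simp only [wp, RamTest.Holds]
  simp only [RamState.reg_setReg, RamState.arr_setReg, h4]
  norm_num
  simp only [h.rev, h.seen, h.one, bit01_eq_one_iff]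
  refine ⟨fun hV => ?_, fun hV => ?_⟩
  · exact BuildInv.next hW hi (h.toHolds.congr (by simp) (by simp)) (hwalk.step hV)
      (by simp [h.zero]) (by simp [h4, hx]) (by simp [h.counter]) (by simp [h.seen])
  · have hT' := hwalk.enter htri hV
    -- Deleting the edge leaves the current dart in place, so register 4 remains correct for the new
    -- tree.
    have hpow := hwalk.pow_tour_remove hV i le_rfl
    rw [← hx] at hT' hpow
    have htree : ∀ d : Fin n, (if d = G.rev x then 0 else if d = x then 0 else s.arr 3 d)
        = bit01 (G.edge d ∈ T \ {G.edge x}) := by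
      intro d
      split_ifs with h1 h2
      · exact (bit01_of_not fun hd => hd.2 (by rw [h1]; exact G.edge_rev x)).symm
      · exact (bit01_of_not fun hd => hd.2 (by rw [h2]; rfl)).symm
      · rw [h.tree]
        have : G.edge d ∈ T \ {G.edge x} ↔ G.edge d ∈ T :=
          ⟨fun hd => hd.1, fun hd => ⟨hd, fun he => (G.edge_eq_iff.1 he).elim h2 h1⟩⟩
        rw [this]
    simp only [block, wp]
    refine wp_markFace htri (r := G.rev x) (V := V) ?_ ?_ ?_ ?_ ?_ fun s' harr hreg hV' => ?_
    · simp [h.one]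
    · simp
    · simpa using h.rev
    · simpa using h.rot
    · simpa using h.seen
    refine BuildInv.next hW hi ⟨?_, ?_, ?_, ?_, ?_, fun d => ?_⟩ hT' ?_ ?_ ?_ hV'
    · simp [hreg, h.size]
    · simp [hreg, h.one]
    · simpa [harr] using h.rev
    · simpa [harr] using h.rot
    · simpa [harr] using h.terminal
    · rw [← htree d]
      simp [harr, h4, h.zero, Fin.val_inj]
    · simp [hreg, h.zero]
    · simp [hreg, h4, hpow]
    · simp [hreg, h.counter]

/-- The state after `i` edges have been put into the tree. -/
structure FillInv (G : CombMap (Fin n)) (X : Set G.Face) (i : ℕ) (s : RamState) : Prop where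
  size : s.reg 0 = n
  one : s.reg 2 = 1
  zero : s.reg 3 = 0
  counter : s.reg 6 = i
  rev : ∀ d : Fin n, s.arr 0 d = G.rev d
  rot : ∀ d : Fin n, s.arr 1 d = G.rot d
  terminal : ∀ d : Fin n, s.arr 2 d = bit01 (G.face d ∈ X)
  filled : ∀ d : Fin n, (d : ℕ) < i → s.arr 3 d = 1
  unseen : ∀ d : Fin n, s.arr 7 d = 0

theorem FillInv.step {i : ℕ} (hW : n ≤ W) (hi : i < n) {s : RamState} (h : FillInv G X i s) :
    (block [store 3 6 2, add 6 6 2]).wp W (FillInv G X (i + 1)) s := by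
  have h6 := h.counter
  have h2 := h.one
  simp only [block, wp, RamState.reg_setArr, h6, h2]
  refine ⟨by omega, ?_, ?_, ?_, ?_, ?_, ?_, ?_, fun d hd => ?_, ?_⟩
  · simp [h.size]
  · simp [h2]
  · simp [h.zero]
  · simp
  · simpa using h.rev
  · simpa using h.rot
  · simpa using h.terminal
  · by_cases hdi : (d : ℕ) = i
    · simp [hdi]
    · simpa [hdi] using h.filled d (by omega)
  · simpa using h.unseen

/-- `n` rounds suffice because an orbit of the walk has at most `n` darts. Array 7 has to start at
zero, as no face has been seen. -/
theorem runs_buildTree (hG : G.IsPlane) (htri : G.IsTriangulated) (hn : 0 < n) (hW : n ≤ W)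
    {s : RamState} (h0 : s.reg 0 = n)
    (hrev : ∀ d : Fin n, s.arr 0 d = G.rev d) (hrot : ∀ d : Fin n, s.arr 1 d = G.rot d)
    (hX2 : ∀ d : Fin n, s.arr 2 d = bit01 (G.face d ∈ X)) (hs7 : ∀ d : Fin n, s.arr 7 d = 0) :
    Runs W buildTree s (100 * n) fun s' => ∃ T : Set G.Edge,
      (∀ x y, (G.tour T).SameCycle x y) ∧ G.Holds X T s' := by
  let x₀ : Fin n := ⟨0, hn⟩
  have init : Runs W (const 2 1) s 1 fun s => s.reg 0 = n ∧ s.reg 2 = 1 ∧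
      (∀ d : Fin n, s.arr 0 d = G.rev d) ∧ (∀ d : Fin n, s.arr 1 d = G.rot d) ∧
      (∀ d : Fin n, s.arr 2 d = bit01 (G.face d ∈ X)) ∧ ∀ d : Fin n, s.arr 7 d = 0 :=
    Runs.of_wp ⟨by omega, by simp [h0, hrev, hrot, hX2, hs7]⟩
  have main := init.seq fun s₁ h₁ => (Runs.of_wp (p := const 3 0)
      (Q := fun s => s.reg 3 = 0 ∧ s.reg 0 = n ∧ s.reg 2 = 1 ∧
      (∀ d : Fin n, s.arr 0 d = G.rev d) ∧ (∀ d : Fin n, s.arr 1 d = G.rot d) ∧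
      (∀ d : Fin n, s.arr 2 d = bit01 (G.face d ∈ X)) ∧ ∀ d : Fin n, s.arr 7 d = 0)
      ⟨by omega, by simpa using h₁⟩).seq
    fun s₂ h₂ => (Runs.of_wp (p := const 6 0) (Q := FillInv G X 0) (by
      obtain ⟨i3, i0, i2, ir, io, it, i7⟩ := h₂
      exact ⟨by omega, by simp [i0], by simp [i2], by simp [i3], by simp, by simpa using ir,
        by simpa using io, by simpa using it, fun d hd => by omega, by simpa using i7⟩)).seq
    fun s₃ h₃ => (Runs.loop (b := .lt 6 0) (FillInv G X) n
      (fun i hi s hs => ⟨by simp only [RamTest.Holds, hs.counter, hs.size]; exact hi,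
        hs.step hW hi⟩)
      (fun s hs => by simp [RamTest.Holds, hs.counter, hs.size]) h₃).seq
    fun s₄ h₄ => (Runs.of_wp (p := block [const 4 0, const 9 0, markFace, const 6 0])
      (Q := fun s => ∃ T V, BuildInv G X x₀ T V 0 s) (by
      simp only [block, wp]
      refine ⟨by omega, by omega, wp_markFace htri (r := x₀) (V := ∅) ?_ ?_ ?_ ?_ ?_
        fun s' harr hreg hV' => ⟨by omega, Set.univ, {G.face x₀}, ⟨?_, ?_, ?_, ?_, ?_, ?_⟩,
          WalkInv.init x₀, ?_, ?_, ?_, ?_⟩⟩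
      · simp [h₄.one]
      · simp [x₀]
      · simpa using h₄.rev
      · simpa using h₄.rot
      · simpa [bit01] using h₄.unseen
      · simp [hreg, h₄.size]
      · simp [hreg, h₄.one]
      · simpa [harr] using h₄.rev
      · simpa [harr] using h₄.rot
      · simpa [harr] using h₄.terminal
      · intro d
        simp [harr, h₄.filled d d.isLt, bit01]
      · simp [hreg, h₄.zero]
      · simp [hreg, x₀]
      · simp
      · simpa using hV')).seq
    fun s₅ h₅ => (Runs.loop (b := .lt 6 0) (fun i s => ∃ T V, BuildInv G X x₀ T V i s) n
      (fun i hi s ⟨T, V, hs⟩ => ⟨by simp only [RamTest.Holds, hs.counter, hs.size]; exact hi,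
        hs.step htri hW hi⟩)
      (fun s ⟨T, V, hs⟩ => by simp [RamTest.Holds, hs.counter, hs.size]) h₅).seq
    fun s₆ h₆ => Runs.of_wp (p := .skip)
      (Q := fun s => ∃ T V, BuildInv G X x₀ T V n s) h₆
  refine main.mono ?_ fun s' ⟨T, V, h⟩ => ⟨T, ?_, h.toHolds⟩
  · simp only [cost, block, buildBody, markFace, stepTour]
    omega
  · exact h.toWalkInv.sameCycle (Fintype.card_fin n).le hG.1

theorem tableArr_apply (g : Fin n → ℕ) (d : Fin n) : tableArr g d = g d := by
  simp [tableArr]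

end CombMap

/-! ### Assembly. -/

theorem mainTheorem2 :
    -- every spanning tree has a balanced fundamental cycle
    (∀ (D : Type*) [Finite D] (G : CombMap D) (infinite : G.Face) (X : Set G.Face)
        (T : Set G.Edge),
      G.IsPlane → G.IsTriangulated → 4 ≤ X.ncard → G.IsSpanningTree T →
      ∃ (e : G.Edge) (c : G.SimpleCycle),
        G.IsFundamentalCycle T e c ∧ G.IsBalanced infinite X c) ∧
    -- linear time, for a given spanning tree
    (∃ (P : RamProg) (C : ℕ), ∀ (n : ℕ) (G : CombMap (Fin n)) (infinite : G.Face)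
        (X : Set G.Face) (T : Set G.Edge),
      G.IsPlane → G.IsTriangulated → 4 ≤ X.ncard → G.IsSpanningTree T →
      ∃ (t : ℕ) (s : RamState),
        RamExec (C * n) P (G.inputState X T) t s ∧ t ≤ C * n ∧
        ∃ (e : G.Edge) (c : G.SimpleCycle),
          G.IsFundamentalCycle T e c ∧ G.IsBalanced infinite X c ∧ G.IsOutput s T e c) ∧
    -- linear time, when only the graph and the terminals are given
    (∃ (P : RamProg) (C : ℕ), ∀ (n : ℕ) (G : CombMap (Fin n)) (infinite : G.Face)
        (X : Set G.Face),
      G.IsPlane → G.IsTriangulated → 4 ≤ X.ncard →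
      ∃ (t : ℕ) (s : RamState),
        RamExec (C * n) P (G.inputState X ∅) t s ∧ t ≤ C * n ∧
        ∃ (T : Set G.Edge) (e : G.Edge) (c : G.SimpleCycle),
          G.IsSpanningTree T ∧ G.IsFundamentalCycle T e c ∧ G.IsBalanced infinite X c ∧
            G.IsOutput s T e c) := by
  refine ⟨fun D _ G => G.exists_balanced_fundamentalCycle, ⟨RamProg.separate, 200, ?_⟩,
    ⟨.seq RamProg.buildTree RamProg.separate, 300, ?_⟩⟩
  · intro n G infinite X T hG htri hX hT
    -- The infinite face contains a dart, so `n` is positive and the walk can start at dart 0.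
    obtain ⟨y, -⟩ := Quotient.exists_rep infinite
    exact CombMap.runs_separate hG htri hX (G.sameCycle_tour_of_isSpanningTree hT) (by omega)
      infinite ⟨0, y.pos⟩ rfl rfl
      (CombMap.tableArr_apply fun d => (G.rev d : ℕ))
      (CombMap.tableArr_apply fun d => (G.rot d : ℕ))
      (CombMap.tableArr_apply fun d => bit01 (G.face d ∈ X))
      (CombMap.tableArr_apply fun d => bit01 (G.edge d ∈ T))
  · intro n G infinite X hG htri hX
    obtain ⟨y, -⟩ := Quotient.exists_rep infinite
    obtain ⟨t, s, hrun, ht, T, e, c, h⟩ := (CombMap.runs_buildTree (W := 300 * n) hG htri y.pos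
      (by omega) (s := G.inputState X ∅) rfl
      (CombMap.tableArr_apply fun d => (G.rev d : ℕ))
      (CombMap.tableArr_apply fun d => (G.rot d : ℕ))
      (CombMap.tableArr_apply fun d => bit01 (G.face d ∈ X)) fun _ => rfl).seq
      fun s₁ ⟨T, hT, h₁⟩ => (CombMap.runs_separate hG htri hX hT (by omega) infinite ⟨0, y.pos⟩
        rfl h₁.size h₁.rev h₁.rot h₁.terminal h₁.tree).mono le_rfl
        -- The construction certifies its edge set only through its contour walk; on the sphere this
        -- makes it a spanning tree.
        fun s' ⟨e, c, hc⟩ => (⟨T, e, c, G.isSpanningTree_of_sameCycle_tour hG hT, hc⟩ :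
          ∃ (T : Set G.Edge) (e : G.Edge) (c : G.SimpleCycle),
            G.IsSpanningTree T ∧ G.IsFundamentalCycle T e c ∧ G.IsBalanced infinite X c ∧
              G.IsOutput s' T e c)
    exact ⟨t, s, hrun, by omega, T, e, c, h⟩
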